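/- Let $N,d\ge 2$ and let $X=(X_1,\dots,X_d)$ be locally Lipschitz vector fields on $\mathbb{R}^N$, $X_j=\sum_k c_{jk}\partial_{x_k}$, with $X$-gradient $X\varphi=(X_1\varphi,\dots,X_d\varphi)$. An absolutely continuous path $\gamma:[0,T]\to\mathbb{R}^N$ is *$X$-subunit* if for a.e. $t$ one has $\dot\gamma(t)=\sum_j\theta_j(t)X_j(\gamma(t))$ with $\sum_j\theta_j(t)^2\le 1$. Assume that any two points of $\mathbb{R}^N$ are joined by an $X$-subunit path, and let $\delta(x,y)$ be the infimum of the $T>0$ for which an $X$-subunit path $\gamma:[0,T]\to\mathbb{R}^N$ with $\gamma(0)=x$, $\gamma(T)=y$ exists. Assume that: 1. $\delta$ is topologically equivalent to the Euclidean distance: $|y_n-x|\to0$ if and only if $\delta(x,y_n)\to0$; 2. $0<|B_{2r}|\le 2^Q|B_r|$ for all $\delta$-balls $B_r$ of radius $r>0$, where $Q$ is a fixed real number and $B_{2r}$ is the concentric ball; 3. there are $C_P,\nu>0$ such that $\frac1{|B_r|}\int_{B_r}|u-u_r|\,dx\le C_P\,r\,\frac1{|B_{\nu r}|}\int_{B_{\nu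 r}}|Xu|\,dx$ for all $\delta$-balls $B_r$ and all $u\in C^1_c(\mathbb{R}^N)$, where $u_r=\frac1{|B_r|}\int_{B_r}u\,dx$ and $B_{\nu r}$ is concentric with $B_r$. Let $\Omega\subset\mathbb{R}^N$ be bounded and open, $1<p<Q$, $p'=\frac{p}{p-1}$, $p'\le m<\frac{Q}{p-1}$, and $\alpha>0$. Let $W^{1,p}_0(\Omega,X)$ be the closure of $C^\infty_c(\Omega)$ in the $X$-Sobolev norm: $u\in W^{1,p}_0(\Omega,X)$ with $X$-gradient $Xu$ if $u\in L^p(\Omega)$, $Xu\in L^p(\Omega)^d$ and there are $\varphi_n\in C_c^\infty(\Omega)$ with $\varphi_n\to u$ in $L^p(\Omega)$ and $X\varphi_n\to Xu$ in $L^p(\Omega)^d$. Then there is a constant $C>0$, depending only on $Q,p,\Omega,\alpha,m,X$, with the following property. Let $\beta>0$, $h\in L^{p'}(\Omega)$, and let $a:\Omega\times\mathbb{R}\times\mathbb{R}^d\to\mathbb{R}^d$ be a Carathéodory function such that for a.e. $x\in\Omega$, all $s\in\mathbb{R}$ and all $\xi\ne\eta$ in $\mathbb{R}^d$, $$a(x,s,\xi)\cdot\xi\ge\alpha|\xi|^p,\qquad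 |a(x,s,\xi)|\le\beta\big(h(x)+|s|^{p-1}+|\xi|^{p-1}\big),\qquad [a(x,s,\xi)-a(x,s,\eta)]\cdot(\xi-\eta)>0.$$ Let $F\in(L^m(\Omega))^d$ and let $u$ be a weak solution of $X^*a(x,u,Xu)=X^*F$ in $\Omega$, $u=0$ on $\partial\Omega$, that is, $u\in W^{1,p}_0(\Omega,X)$ and $$\int_\Omega a(x,u,Xu)\cdot Xv\,dx=\int_\Omega F\cdot Xv\,dx\qquad\text{for all } v\in W^{1,p}_0(\Omega,X).$$ Then $u\in L^q(\Omega)$ with $$q=[m(p-1)]^*=\frac{m(p-1)Q}{Q-m(p-1)},\qquad r^*:=\frac{rQ}{Q-r},$$ and $$\|u\|_{L^q(\Omega)}\le C\,\|F\|_{L^m(\Omega)}^{\frac1{p-1}}.$$ -/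

import Mathlib

open MeasureTheory Filter Topology
open scoped ContDiff

noncomputable section

/-- The `X`-gradient `Xu = (X₁u, …, X_d u)`, `X_j u = ∑ₖ c_{jk} ∂ₖ u`, of a differentiable function,
for vector fields `X_j = (c_{j1}, …, c_{jN})` on `ℝ^N`. -/
def xGrad {N d : ℕ} (X : Fin d → EuclideanSpace ℝ (Fin N) → EuclideanSpace ℝ (Fin N))
    (u : EuclideanSpace ℝ (Fin N) → ℝ) (x : EuclideanSpace ℝ (Fin N)) :
    EuclideanSpace ℝ (Fin d) :=
  WithLp.toLp 2 fun j => fderiv ℝ u x (X j x)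

/-- `γ : [0, T] → ℝ^N` is an `X`-subunit path: it is absolutely continuous, and for almost every
`t ∈ [0, T]` one has `γ'(t) = ∑ⱼ θⱼ(t) X_j(γ(t))` with `∑ⱼ θⱼ(t)² ≤ 1`. -/
def IsSubunitPath {N d : ℕ} (X : Fin d → EuclideanSpace ℝ (Fin N) → EuclideanSpace ℝ (Fin N))
    (T : ℝ) (γ : ℝ → EuclideanSpace ℝ (Fin N)) : Prop :=
  AbsolutelyContinuousOnInterval γ 0 T ∧
    ∀ᵐ t ∂(volume.restrict (Set.Icc (0 : ℝ) T)), ∃ θ : Fin d → ℝ,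
      ∑ j, θ j ^ 2 ≤ 1 ∧ HasDerivAt γ (∑ j, θ j • X j (γ t)) t

/-- The times `T > 0` in which `y` can be reached from `x` along an `X`-subunit path. -/
def subunitTimes {N d : ℕ} (X : Fin d → EuclideanSpace ℝ (Fin N) → EuclideanSpace ℝ (Fin N))
    (x y : EuclideanSpace ℝ (Fin N)) : Set ℝ :=
  {T : ℝ | 0 < T ∧ ∃ γ : ℝ → EuclideanSpace ℝ (Fin N), IsSubunitPath X T γ ∧ γ 0 = x ∧ γ T = y}

/-- `ℝ^N` is `X`-connected: any two points are joined by an `X`-subunit path. -/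
def IsXConnected {N d : ℕ}
    (X : Fin d → EuclideanSpace ℝ (Fin N) → EuclideanSpace ℝ (Fin N)) : Prop :=
  ∀ x y, (subunitTimes X x y).Nonempty

/-- The Carnot–Carathéodory (control) distance; only used when `ℝ^N` is `X`-connected. -/
def ccDist {N d : ℕ} (X : Fin d → EuclideanSpace ℝ (Fin N) → EuclideanSpace ℝ (Fin N))
    (x y : EuclideanSpace ℝ (Fin N)) : ℝ :=
  sInf (subunitTimes X x y)

/-- The open ball of the control distance. -/
def ccBall {N d : ℕ} (X : Fin d → EuclideanSpace ℝ (Fin N) → EuclideanSpace ℝ (Fin N))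
    (x : EuclideanSpace ℝ (Fin N)) (r : ℝ) : Set (EuclideanSpace ℝ (Fin N)) :=
  {y | ccDist X x y < r}

/-- The control distance is (topologically) equivalent to the Euclidean one. -/
def CCDistEquivEuclidean {N d : ℕ}
    (X : Fin d → EuclideanSpace ℝ (Fin N) → EuclideanSpace ℝ (Fin N)) : Prop :=
  ∀ (x : EuclideanSpace ℝ (Fin N)) (y : ℕ → EuclideanSpace ℝ (Fin N)),
    Tendsto (fun n => ‖y n - x‖) atTop (𝓝 0) ↔ Tendsto (fun n => ccDist X x (y n)) atTop (𝓝 0)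

/-- `0 < |B_{2r}| ≤ 2^Q |B_r|` for all control balls. -/
def IsCCDoubling {N d : ℕ} (X : Fin d → EuclideanSpace ℝ (Fin N) → EuclideanSpace ℝ (Fin N))
    (Q : ℝ) : Prop :=
  ∀ (x : EuclideanSpace ℝ (Fin N)) (r : ℝ), 0 < r →
    0 < volume (ccBall X x (2 * r)) ∧
      volume (ccBall X x (2 * r)) ≤ ENNReal.ofReal (2 ^ Q) * volume (ccBall X x r)

/-- The `(1,1)`-Poincaré inequality on all control balls. It is only required of compactly supported
`C¹` functions on `ℝ^N`; these are in particular `C¹` on the closure of every ball, so this is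
implied by the inequality for all functions that are `C¹` on the closure of `B_{νr}`. -/
def SupportsPoincare {N d : ℕ}
    (X : Fin d → EuclideanSpace ℝ (Fin N) → EuclideanSpace ℝ (Fin N)) : Prop :=
  ∃ C_P : ℝ, 0 < C_P ∧ ∃ ν : ℝ, 0 < ν ∧
    ∀ (x : EuclideanSpace ℝ (Fin N)) (r : ℝ), 0 < r →
      ∀ u : EuclideanSpace ℝ (Fin N) → ℝ, ContDiff ℝ 1 u → HasCompactSupport u →
        (⨍ y in ccBall X x r, |u y - ⨍ z in ccBall X x r, u z|) ≤
          C_P * r * ⨍ y in ccBall X x (ν * r), ‖xGrad X u y‖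

/-- `u ∈ W^{1,p}_0(Ω, X)` with `X`-gradient `Xu = Du`: the pair `(u, Du)` is the limit, in
`L^p(Ω) × L^p(Ω)^d`, of pairs `(φₙ, Xφₙ)` with `φₙ ∈ C^∞_c(Ω)`. -/
structure IsSobolevZero {N d : ℕ}
    (X : Fin d → EuclideanSpace ℝ (Fin N) → EuclideanSpace ℝ (Fin N))
    (Ω : Set (EuclideanSpace ℝ (Fin N))) (p : ℝ)
    (u : EuclideanSpace ℝ (Fin N) → ℝ)
    (Du : EuclideanSpace ℝ (Fin N) → EuclideanSpace ℝ (Fin d)) : Prop where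
  memLp : MemLp u (ENNReal.ofReal p) (volume.restrict Ω)
  memLp_grad : MemLp Du (ENNReal.ofReal p) (volume.restrict Ω)
  approx : ∃ φ : ℕ → EuclideanSpace ℝ (Fin N) → ℝ,
    (∀ n, ContDiff ℝ ∞ (φ n) ∧ HasCompactSupport (φ n) ∧ tsupport (φ n) ⊆ Ω) ∧
    Tendsto (fun n => eLpNorm (fun x => φ n x - u x) (ENNReal.ofReal p) (volume.restrict Ω))
      atTop (𝓝 0) ∧
    Tendsto (fun n => eLpNorm (fun x => xGrad X (φ n) x - Du x) (ENNReal.ofReal p)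
      (volume.restrict Ω)) atTop (𝓝 0)

/-- The structural assumptions on the Carathéodory function `a : Ω × ℝ × ℝ^d → ℝ^d`. -/
structure IsLerayLions {N d : ℕ} (Ω : Set (EuclideanSpace ℝ (Fin N))) (p α β : ℝ)
    (h : EuclideanSpace ℝ (Fin N) → ℝ)
    (a : EuclideanSpace ℝ (Fin N) → ℝ → EuclideanSpace ℝ (Fin d) → EuclideanSpace ℝ (Fin d)) :
    Prop where
  measurable : ∀ s ξ, AEMeasurable (fun x => a x s ξ) (volume.restrict Ω)
  continuous : ∀ᵐ x ∂(volume.restrict Ω),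
    Continuous fun z : ℝ × EuclideanSpace ℝ (Fin d) => a x z.1 z.2
  elliptic : ∀ᵐ x ∂(volume.restrict Ω), ∀ s ξ, α * ‖ξ‖ ^ p ≤ inner ℝ (a x s ξ) ξ
  growth : ∀ᵐ x ∂(volume.restrict Ω), ∀ s ξ,
    ‖a x s ξ‖ ≤ β * (h x + |s| ^ (p - 1) + ‖ξ‖ ^ (p - 1))
  monotone : ∀ᵐ x ∂(volume.restrict Ω), ∀ s ξ η, ξ ≠ η →
    0 < inner ℝ (a x s ξ - a x s η) (ξ - η)

/-- `u ∈ W^{1,p}_0(Ω, X)` is a weak solution of `X^* a(x, u, Xu) = X^* F` in `Ω`, `u = 0` on `∂Ω`. -/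
def IsWeakSolution {N d : ℕ}
    (X : Fin d → EuclideanSpace ℝ (Fin N) → EuclideanSpace ℝ (Fin N))
    (Ω : Set (EuclideanSpace ℝ (Fin N))) (p : ℝ)
    (a : EuclideanSpace ℝ (Fin N) → ℝ → EuclideanSpace ℝ (Fin d) → EuclideanSpace ℝ (Fin d))
    (F : EuclideanSpace ℝ (Fin N) → EuclideanSpace ℝ (Fin d))
    (u : EuclideanSpace ℝ (Fin N) → ℝ) : Prop :=
  ∃ Du : EuclideanSpace ℝ (Fin N) → EuclideanSpace ℝ (Fin d), IsSobolevZero X Ω p u Du ∧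
    ∀ (v : EuclideanSpace ℝ (Fin N) → ℝ) (Dv : EuclideanSpace ℝ (Fin N) → EuclideanSpace ℝ (Fin d)),
      IsSobolevZero X Ω p v Dv →
        ∫ x in Ω, inner ℝ (a x (u x) (Du x)) (Dv x) = ∫ x in Ω, inner ℝ (F x) (Dv x)

/-- The Sobolev exponent `r^* = rQ / (Q - r)`, for `r < Q`. -/
def sobolevExponent (Q r : ℝ) : ℝ := r * Q / (Q - r)

end

/-! The estimate combines a Sobolev inequality on `W^{1,p}_0(Ω, X)` with a nonlinear test function.
Write `r = p^*`, `p' = p/(p-1)`, `κ = 1 - p'/m`, and choose `s` with `r(1+2s) = q`. Testing with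
`∫₀ᵘ w^p` for a positive bounded weight `w`, ellipticity and Young's inequality give `∫ |w(u) Xu|^p
≤ c ∫ |F|^{p'} w(u)^p` (`IsLerayLions.lintegral_energy_le`). Formally `w(t) = |t|^{2s}`: the
primitive of `w` is comparable with `|t|^{1+2s}`, so Sobolev on the left and Hölder on the right
yield `(∫|u|^q)^{p/r} ≤ c ‖F‖_m^{p'} (∫|u|^q)^κ`. Since `p/r = κ + p/q`, absorption leaves `‖u‖_q^p
≤ c ‖F‖_m^{p'}`, and `p'/p = 1/(p-1)`.

Absorption requires a finite left side, and `|t|^{2s}` is neither bounded nor, in general, smooth.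
It is replaced by `regSq ε t ^ s`, which is smooth, positive and bounded, so that the chain rule is
needed only for smooth functions with bounded derivative. The bounds are uniform up to an error
vanishing with `ε`, and Fatou's lemma concludes. The growth of `a` only serves integrability, so `β`
and `h` do not enter the constant.

The Sobolev inequality comes from doubling and Poincaré on control balls. Telescoping averages over
shrinking balls bounds `|φ(x)|` by `∑ 2^{-i} ⨍ |Xφ|` (`IsDoublingWith.abs_le_dyadic_potential`); the
first average is controlled because `φ` vanishes on half of a large ball. Hedberg's interpolation
bounds this sum by `M(|Xφ|)(x)^{1-p/Q} ‖Xφ‖_p^{p/Q}`, and the maximal theorem in `L^p` finishes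
(`IsDoublingWith.exists_sobolev_of_le_potential`). -/

open Set in
/-- Precomposing an absolutely continuous function with a monotone or antitone `1`-Lipschitz change
of variable gives an absolutely continuous function. -/
theorem AbsolutelyContinuousOnInterval.comp_of_monotone_or_antitone {Y : Type*} [PseudoMetricSpace Y]
    {f : ℝ → Y} {a b c d : ℝ} {φ : ℝ → ℝ} (hf : AbsolutelyContinuousOnInterval f c d)
    (hφ : Monotone φ ∨ Antitone φ) (hlip : ∀ x y, dist (φ x) (φ y) ≤ dist x y)
    (hmaps : MapsTo φ (uIcc a b) (uIcc c d)) :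
    AbsolutelyContinuousOnInterval (f ∘ φ) a b := by
  rw [absolutelyContinuousOnInterval_iff] at hf ⊢
  intro ε hε
  obtain ⟨δ, hδ, H⟩ := hf ε hε
  refine ⟨δ, hδ, fun E hE hlen => ?_⟩
  refine H (E.1, fun i => (φ (E.2 i).1, φ (E.2 i).2)) ⟨fun i hi => ⟨hmaps (hE.1 i hi).1,
    hmaps (hE.1 i hi).2⟩, fun i hi j hj hij => ?_⟩ ((Finset.sum_le_sum fun i _ => hlip _ _).trans_lt hlen)
  have h := hE.2 hi hj hij
  simp only [Function.onFun] at h ⊢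
  generalize (E.2 i).1 = x at *
  generalize (E.2 i).2 = y at *
  generalize (E.2 j).1 = x' at *
  generalize (E.2 j).2 = y' at *
  -- Half-open intervals are disjoint when the smaller right end is at most the larger left end. A
  -- monotone map preserves this inequality; an antitone one exchanges minima and maxima.
  simp only [uIoc, Ioc_disjoint_Ioc] at h ⊢
  rcases hφ with hφ | hφ
  · simpa only [hφ.map_max, hφ.map_min] using hφ h
  · have := hφ h
    simp only [hφ.map_max, hφ.map_min] at this
    rwa [min_comm (φ x), min_comm (φ x'), max_comm (φ x), max_comm (φ x')] at *

/-! ### The control distance as a pseudometric -/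

section Paths

variable {N d : ℕ} {X : Fin d → EuclideanSpace ℝ (Fin N) → EuclideanSpace ℝ (Fin N)}

theorem IsSubunitPath.reverse {T : ℝ} {γ : ℝ → EuclideanSpace ℝ (Fin N)} (hT : 0 < T)
    (h : IsSubunitPath X T γ) : IsSubunitPath X T (fun t => γ (T - t)) := by
  refine ⟨h.1.comp_of_monotone_or_antitone (φ := fun t => T - t)
    (Or.inr fun x y hxy => by dsimp only; linarith) (fun x y => by simp only [Real.dist_eq]; grind) ?_, ?_⟩
  · intro t ht
    rw [Set.uIcc_of_le hT.le] at ht ⊢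
    exact ⟨by linarith [ht.2], by linarith [ht.1]⟩
  · have h2 := h.2
    rw [ae_restrict_iff' measurableSet_Icc] at h2 ⊢
    have h3 := (quasiMeasurePreserving_sub_left_of_right_invariant volume T).ae h2
    filter_upwards [h3] with t ht htI
    obtain ⟨θ, hθ, hd⟩ := ht ⟨by linarith [htI.2], by linarith [htI.1]⟩
    refine ⟨fun j => - θ j, by simpa using hθ, ?_⟩
    have := hd.scomp t ((hasDerivAt_id t).const_sub T)
    simpa [Function.comp_def] using this

theorem IsSubunitPath.concat {S T : ℝ} {γ η : ℝ → EuclideanSpace ℝ (Fin N)} (hS : 0 < S) (hT : 0 < T)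
    (hγ : IsSubunitPath X S γ) (hη : IsSubunitPath X T η) (hγη : γ S = η 0) :
    IsSubunitPath X (S + T) (fun t => if t ≤ S then γ t else η (t - S)) := by
  constructor
  -- Each path is extended to `[0, S + T]` by clamping its time; the concatenation is then the sum
  -- of the two extensions minus the common value `η 0`.
  · have h1 := hγ.1.comp_of_monotone_or_antitone (a := 0) (b := S + T) (φ := fun t => max 0 (min t S))
      (Or.inl fun x y hxy => by dsimp only; gcongr)
      (fun x y => by simp only [Real.dist_eq]; grind) (fun t ht => by
        rw [Set.uIcc_of_le (by linarith)] at ht ⊢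
        simp [hS.le])
    have h2 := hη.1.comp_of_monotone_or_antitone (a := 0) (b := S + T) (φ := fun t => max 0 (t - S))
      (Or.inl fun x y hxy => by dsimp only; gcongr)
      (fun x y => by simp only [Real.dist_eq]; grind) (fun t ht => by
        rw [Set.uIcc_of_le (by linarith)] at ht ⊢
        simp only [Set.mem_Icc, le_max_left, true_and]
        grind)
    have h3 := (h1.add h2).sub (g := fun _ => η 0)
      (LipschitzWith.const (η 0)).lipschitzOnWith.absolutelyContinuousOnInterval
    rw [AbsolutelyContinuousOnInterval] at h3 ⊢
    refine h3.congr' ?_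
    rw [Filter.EventuallyEq, eventually_inf_principal]
    refine Eventually.of_forall fun E hE => Finset.sum_congr rfl fun i hi => ?_
    have key : ∀ t ∈ Set.uIcc 0 (S + T), ((γ ∘ fun t => max 0 (min t S)) +
        (η ∘ fun t => max 0 (t - S)) - fun _ => η 0 : ℝ → EuclideanSpace ℝ (Fin N)) t = if t ≤ S then γ t else η (t - S) := by
      intro t ht
      rw [Set.uIcc_of_le (by linarith)] at ht
      split_ifs with h
      · simp [h, ht.1]
      · push Not at h
        simp [h.le, hS.le, hγη]
    rw [key _ (hE.1 i hi).1, key _ (hE.1 i hi).2]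
  · have h1 := hγ.2
    have h2 := hη.2
    rw [ae_restrict_iff' measurableSet_Icc] at h1 h2 ⊢
    have h3 := (measurePreserving_sub_right volume S).quasiMeasurePreserving.ae h2
    filter_upwards [h1, h3, (Set.countable_singleton S).ae_notMem volume] with t ht1 ht2 hne htI
    have hne' : t ≠ S := hne
    rcases lt_or_gt_of_ne hne' with hlt | hlt
    · obtain ⟨θ, hθ, hd⟩ := ht1 ⟨htI.1, hlt.le⟩
      refine ⟨θ, hθ, ?_⟩
      simp only [hlt.le, if_true]
      refine hd.congr_of_eventuallyEq ?_
      filter_upwards [Iio_mem_nhds hlt] with s hs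
      simp [(Set.mem_Iio.1 hs).le]
    · obtain ⟨θ, hθ, hd⟩ := ht2 ⟨by linarith, by linarith [htI.2]⟩
      refine ⟨θ, hθ, ?_⟩
      simp only [not_le.2 hlt, if_false]
      have := hd.scomp t ((hasDerivAt_id t).sub_const S)
      rw [one_smul] at this
      refine this.congr_of_eventuallyEq ?_
      filter_upwards [Ioi_mem_nhds hlt] with s hs
      simp [not_le.2 (Set.mem_Ioi.1 hs)]

theorem ccDist_nonneg (x y : EuclideanSpace ℝ (Fin N)) : 0 ≤ ccDist X x y :=
  Real.sInf_nonneg fun _ h => h.1.le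

theorem bddBelow_subunitTimes (x y : EuclideanSpace ℝ (Fin N)) : BddBelow (subunitTimes X x y) :=
  ⟨0, fun _ h => h.1.le⟩

theorem ccDist_self (x : EuclideanSpace ℝ (Fin N)) : ccDist X x x = 0 := by
  refine le_antisymm (le_of_forall_pos_le_add fun ε hε => ?_) (ccDist_nonneg x x)
  rw [zero_add]
  refine csInf_le (bddBelow_subunitTimes x x) ⟨hε, fun _ => x, ⟨?_, ?_⟩, rfl, rfl⟩
  · exact (LipschitzWith.const x).lipschitzOnWith.absolutelyContinuousOnInterval
  · exact Eventually.of_forall fun t => ⟨0, by simp, by simpa using hasDerivAt_const t x⟩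

theorem ccDist_comm (x y : EuclideanSpace ℝ (Fin N)) : ccDist X x y = ccDist X y x := by
  have key : ∀ x y, subunitTimes X x y ⊆ subunitTimes X y x := by
    rintro x y T ⟨hT, γ, hγ, h0, h1⟩
    exact ⟨hT, _, hγ.reverse hT, by simpa using h1, by simpa using h0⟩
  rw [ccDist, ccDist, (key x y).antisymm (key y x)]

theorem ccDist_triangle (hX : IsXConnected X) (x y z : EuclideanSpace ℝ (Fin N)) :
    ccDist X x z ≤ ccDist X x y + ccDist X y z := by
  refine le_of_forall_pos_le_add fun ε hε => ?_
  obtain ⟨S, ⟨hS, γ, hγ, hγ0, hγ1⟩, hS'⟩ := Real.lt_sInf_add_pos (hX x y) (half_pos hε)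
  obtain ⟨T, ⟨hT, η, hη, hη0, hη1⟩, hT'⟩ := Real.lt_sInf_add_pos (hX y z) (half_pos hε)
  have : ccDist X x z ≤ S + T := csInf_le (bddBelow_subunitTimes x z)
    ⟨by positivity, _, hγ.concat hS hT hη (hγ1.trans hη0.symm), by simp [hS.le, hγ0],
      by simp [hT, hη1]⟩
  change S < ccDist X x y + _ at hS'
  change T < ccDist X y z + _ at hT'
  linarith

/-- The pseudometric of the control distance, with its own topology. -/
@[reducible] noncomputable def ccPseudoMetricAux (hX : IsXConnected X) :
    PseudoMetricSpace (EuclideanSpace ℝ (Fin N)) where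
  dist := ccDist X
  dist_self := ccDist_self
  dist_comm := ccDist_comm
  dist_triangle := ccDist_triangle hX

/-- The hypothesis compares convergent sequences only; this suffices because both topologies are
first countable. With equal topologies, the Euclidean Borel structure and second countability apply
to control balls. -/
theorem ccPseudoMetricAux_topology (hX : IsXConnected X) (hE : CCDistEquivEuclidean X) :
    (inferInstance : TopologicalSpace (EuclideanSpace ℝ (Fin N))) =
      (ccPseudoMetricAux hX).toUniformSpace.toTopologicalSpace := by
  have key : ∀ (x : EuclideanSpace ℝ (Fin N)) (y : ℕ → EuclideanSpace ℝ (Fin N)),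
      Tendsto y atTop (𝓝 x) ↔
        Tendsto y atTop (@nhds _ (ccPseudoMetricAux hX).toUniformSpace.toTopologicalSpace x) := by
    intro x y
    rw [tendsto_iff_norm_sub_tendsto_zero, hE x y,
      @tendsto_iff_dist_tendsto_zero _ _ (ccPseudoMetricAux hX)]
    change _ ↔ Tendsto (fun n => ccDist X (y n) x) atTop (𝓝 0)
    simp only [ccDist_comm x]
  refine TopologicalSpace.ext_nhds fun x => le_antisymm ?_ ?_
  · exact tendsto_id'.1 (tendsto_of_seq_tendsto fun y hy => (key x y).1 hy)
  · exact tendsto_id'.1 (@tendsto_of_seq_tendsto _ _ _ _ _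
      ((fun (α : Type) (_ : PseudoMetricSpace α) (x : α) =>
        (inferInstance : (𝓝 x).IsCountablyGenerated)) _ (ccPseudoMetricAux hX) x)
      fun y hy => (key x y).2 hy)

/-- The pseudometric of the control distance, with the Euclidean topology. -/
@[reducible] noncomputable def ccPseudoMetric (hX : IsXConnected X) (hE : CCDistEquivEuclidean X) :
    PseudoMetricSpace (EuclideanSpace ℝ (Fin N)) :=
  (ccPseudoMetricAux hX).replaceTopology (ccPseudoMetricAux_topology hX hE)

end Paths

/-! ### The maximal theorem in doubling spaces -/

section DyadicMaximal

open Metric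
open scoped ENNReal

variable {α : Type*} [PseudoMetricSpace α] [MeasurableSpace α]

/-- The centred maximal function over the balls of radius `ρ / 2 ^ i`, `i ∈ ℕ`. -/
noncomputable def dyadicMaximal (μ : Measure α) (ρ : ℝ) (g : α → ℝ≥0∞) (x : α) : ℝ≥0∞ :=
  ⨆ i : ℕ, (μ (ball x (ρ / 2 ^ i)))⁻¹ * ∫⁻ y in ball x (ρ / 2 ^ i), g y ∂μ

/-- `μ` is doubling with constant `D`, and all balls have positive and finite measure. -/
structure IsDoublingWith (μ : Measure α) (D : ℝ≥0∞) : Prop where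
  ne_top : D ≠ ⊤
  pos : ∀ x r, 0 < r → μ (ball x r) ≠ 0
  fin : ∀ x r, 0 < r → μ (ball x r) ≠ ⊤
  doubling : ∀ x r, 0 < r → μ (ball x (2 * r)) ≤ D * μ (ball x r)

variable {μ : Measure α} {D : ℝ≥0∞} {ρ : ℝ} {g : α → ℝ≥0∞}

theorem average_le_dyadicMaximal (x : α) (i : ℕ) :
    (μ (ball x (ρ / 2 ^ i)))⁻¹ * ∫⁻ y in ball x (ρ / 2 ^ i), g y ∂μ ≤ dyadicMaximal μ ρ g x :=
  le_iSup (fun i : ℕ => (μ (ball x (ρ / 2 ^ i)))⁻¹ * ∫⁻ y in ball x (ρ / 2 ^ i), g y ∂μ) i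

theorem IsDoublingWith.average_const (h : IsDoublingWith μ D) (hρ : 0 < ρ) (x : α) (i : ℕ)
    (c : ℝ≥0∞) : (μ (ball x (ρ / 2 ^ i)))⁻¹ * ∫⁻ _ in ball x (ρ / 2 ^ i), c ∂μ = c := by
  rw [setLIntegral_const, mul_left_comm, ENNReal.inv_mul_cancel (h.pos x _ (by positivity))
    (h.fin x _ (by positivity)), mul_one]

/-- Ensures that the maximal function of a bounded function is finite, so that `toReal` loses
nothing. -/
theorem IsDoublingWith.dyadicMaximal_le (h : IsDoublingWith μ D) (hρ : 0 < ρ) {c : ℝ≥0∞}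
    (hg : ∀ x, g x ≤ c) (x : α) : dyadicMaximal μ ρ g x ≤ c := by
  refine iSup_le fun i => ?_
  rw [← h.average_const hρ x i c]
  gcongr with y
  exact hg y

variable [SecondCountableTopology α] [OpensMeasurableSpace α]

theorem measurable_setLIntegral_ball [SFinite μ] (hg : Measurable g) (r : ℝ) :
    Measurable fun x => ∫⁻ y in ball x r, g y ∂μ := by
  have hs : MeasurableSet {q : α × α | dist q.2 q.1 < r} :=
    (isOpen_lt (by fun_prop) continuous_const).measurableSet
  have h := ((hg.comp measurable_snd).indicator hs).lintegral_prod_right' (ν := μ)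
  convert! h using 2 with x
  rw [← lintegral_indicator measurableSet_ball]
  rfl

theorem measurable_dyadicMaximal [SFinite μ] (hg : Measurable g) :
    Measurable (dyadicMaximal μ ρ g) := by
  refine Measurable.iSup fun i => ?_
  refine Measurable.mul (Measurable.inv ?_) (measurable_setLIntegral_ball hg _)
  simpa using measurable_setLIntegral_ball (μ := μ) (measurable_const (a := (1 : ℝ≥0∞))) (ρ / 2 ^ i)

/-- The weak type `(1, 1)` inequality. -/
theorem IsDoublingWith.mul_meas_lt_dyadicMaximal_le (h : IsDoublingWith μ D) (hρ : 0 < ρ)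
    {t : ℝ≥0∞} : t * μ {x | t < dyadicMaximal μ ρ g x} ≤ D ^ 2 * ∫⁻ y, g y ∂μ := by
  set S := {x | t < dyadicMaximal μ ρ g x} with hS
  have hex : ∀ x, ∃ i : ℕ, x ∈ S →
      t < (μ (ball x (ρ / 2 ^ i)))⁻¹ * ∫⁻ y in ball x (ρ / 2 ^ i), g y ∂μ := by
    intro x
    by_cases hx : x ∈ S
    · obtain ⟨i, hi⟩ := lt_iSup_iff.1 (Set.mem_ofPred_eq.mp hx)
      exact ⟨i, fun _ => hi⟩
    · exact ⟨0, fun h => absurd h hx⟩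
  choose i hi using hex
  set r : α → ℝ := fun x => ρ / 2 ^ i x with hr
  have hr0 : ∀ x, 0 < r x := fun x => by positivity
  -- Vitali selection: the chosen balls are disjoint and their fourfold enlargements cover `S`. Two
  -- doublings pay for the enlargement, whence `D ^ 2`.
  obtain ⟨u, huS, hdisj, hcov⟩ := Vitali.exists_disjoint_subfamily_covering_enlargement_ball
    S id r ρ (fun x _ => div_le_self hρ.le (one_le_pow₀ one_le_two)) 4 (by norm_num)
  have hcount : u.Countable := hdisj.countable_of_isOpen (fun _ _ => isOpen_ball)
    fun x _ => ⟨x, mem_ball_self (hr0 x)⟩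
  have hball : ∀ x ∈ S, t * μ (ball x (r x)) ≤ ∫⁻ y in ball x (r x), g y ∂μ := by
    intro x hx
    have h1 := (hi x hx).le
    rwa [mul_comm, ← div_eq_mul_inv, ENNReal.le_div_iff_mul_le (Or.inl (h.pos x _ (hr0 x)))
      (Or.inl (h.fin x _ (hr0 x)))] at h1
  have h4 : ∀ x, μ (ball x (4 * r x)) ≤ D ^ 2 * μ (ball x (r x)) := by
    intro x
    have e : 4 * r x = 2 * (2 * r x) := by ring
    rw [e, sq, mul_assoc]
    exact (h.doubling x _ (by have := hr0 x; positivity)).trans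
      (mul_le_mul_right (h.doubling x _ (hr0 x)) D)
  have hsub : S ⊆ ⋃ b ∈ u, ball b (4 * r b) := by
    intro x hx
    obtain ⟨b, hb, hxb⟩ := hcov x hx
    exact Set.mem_biUnion hb (hxb (mem_ball_self (hr0 x)))
  calc t * μ S ≤ t * ∑' b : u, μ (ball (b : α) (4 * r b)) := by
        gcongr
        exact (measure_mono hsub).trans (measure_biUnion_le μ hcount _)
    _ = ∑' b : u, t * μ (ball (b : α) (4 * r b)) := ENNReal.tsum_mul_left.symm
    _ ≤ ∑' b : u, D ^ 2 * ∫⁻ y in ball (b : α) (r b), g y ∂μ := by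
        refine ENNReal.tsum_le_tsum fun b => ?_
        calc t * μ (ball (b : α) (4 * r b)) ≤ t * (D ^ 2 * μ (ball (b : α) (r b))) := by
              gcongr; exact h4 b
          _ = D ^ 2 * (t * μ (ball (b : α) (r b))) := by ring
          _ ≤ _ := by gcongr; exact hball b (huS b.2)
    _ = D ^ 2 * ∫⁻ y in ⋃ b ∈ u, ball b (r b), g y ∂μ := by
        rw [ENNReal.tsum_mul_left]
        exact congrArg _
          (lintegral_biUnion hcount (fun _ _ => measurableSet_ball) hdisj (f := g)).symm
    _ ≤ D ^ 2 * ∫⁻ y, g y ∂μ := by gcongr; exact Measure.restrict_le_self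

/-- The Hardy-Littlewood maximal inequality in `L^p`, `1 < p`, for bounded functions. -/
theorem IsDoublingWith.exists_lintegral_dyadicMaximal_rpow_le [SFinite μ] (h : IsDoublingWith μ D)
    (hρ : 0 < ρ) {p : ℝ} (hp : 1 < p) :
    ∃ C : ℝ≥0∞, C ≠ ⊤ ∧ ∀ (g : α → ℝ), Measurable g → (∀ x, 0 ≤ g x) →
      ∫⁻ x, ENNReal.ofReal ((dyadicMaximal μ ρ (fun y => ENNReal.ofReal (g y)) x).toReal ^ p) ∂μ ≤
        C * ∫⁻ x, ENNReal.ofReal (g x ^ p) ∂μ := by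
  refine ⟨ENNReal.ofReal p * ((2 * D ^ 2) * ((ENNReal.ofReal (p - 1))⁻¹ *
    ENNReal.ofReal (2 ^ (p - 1)))), ?_, fun g hg hg0 => ?_⟩
  · have := h.ne_top
    have h1 : ENNReal.ofReal (p - 1) ≠ 0 := by simpa using hp
    finiteness
  set G : α → ℝ≥0∞ := fun y => ENNReal.ofReal (g y) with hG
  have hGm : Measurable G := hg.ennreal_ofReal
  set M : α → ℝ := fun x => (dyadicMaximal μ ρ G x).toReal with hM
  set ν := μ.withDensity G with hν
  -- Marcinkiewicz truncation: where `2g ≤ s`, `g` adds at most `s/2` to the maximal function, so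
  -- the weak type bound at height `s/2` is applied to `g` restricted to `2g > s`. The measure `ν`
  -- of density `g` turns the result into a layer-cake integrand of exponent `p - 1`; the density
  -- supplies the missing power.
  have level : ∀ s : ℝ, 0 < s → μ {x | s < M x} * ENNReal.ofReal (s ^ (p - 1)) ≤
      (2 * D ^ 2) * (ν {x | s < 2 * g x} * ENNReal.ofReal (s ^ (p - 1 - 1))) := by
    intro s hs
    set T := {x | s < 2 * g x} with hT
    have hTm : MeasurableSet T := measurableSet_lt measurable_const (by fun_prop)
    have hsplit : ∀ x, dyadicMaximal μ ρ G x ≤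
        dyadicMaximal μ ρ (T.indicator G) x + ENNReal.ofReal (s / 2) := by
      intro x
      refine iSup_le fun i => ?_
      rw [← h.average_const hρ x i (ENNReal.ofReal (s / 2))]
      refine le_trans ?_ (add_le_add_left (average_le_dyadicMaximal x i) _)
      rw [← mul_add, ← lintegral_add_right _ measurable_const]
      gcongr with y
      by_cases hy : y ∈ T
      · simp [hy]
      · simp only [hy, not_false_eq_true, Set.indicator_of_notMem, zero_add]
        refine ENNReal.ofReal_le_ofReal ?_
        simp only [hT, Set.mem_ofPred_eq, not_lt] at hy
        linarith
    have hsub : {x | s < M x} ⊆ {x | ENNReal.ofReal (s / 2) < dyadicMaximal μ ρ (T.indicator G) x} := by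
      intro x hx
      by_contra hcon
      simp only [Set.mem_ofPred_eq, not_lt] at hx hcon
      have h1 : dyadicMaximal μ ρ G x ≤ ENNReal.ofReal s := by
        refine (hsplit x).trans ((add_le_add_left hcon _).trans ?_)
        rw [← ENNReal.ofReal_add (by positivity) (by positivity), add_halves]
      have h2 := ENNReal.toReal_le_of_le_ofReal hs.le h1
      exact absurd hx (not_lt.2 h2)
    have hweak := h.mul_meas_lt_dyadicMaximal_le hρ (t := ENNReal.ofReal (s / 2)) (g := T.indicator G)
    rw [lintegral_indicator hTm, ← withDensity_apply _ hTm] at hweak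
    have hexp : ENNReal.ofReal (s ^ (p - 1)) =
        2 * (ENNReal.ofReal (s / 2) * ENNReal.ofReal (s ^ (p - 1 - 1))) := by
      rw [← ENNReal.ofReal_mul (by positivity), ← ENNReal.ofReal_ofNat 2,
        ← ENNReal.ofReal_mul (by positivity), Real.rpow_sub_one hs.ne' (p - 1)]
      congr 1
      field_simp
    calc μ {x | s < M x} * ENNReal.ofReal (s ^ (p - 1))
        ≤ μ {x | ENNReal.ofReal (s / 2) < dyadicMaximal μ ρ (T.indicator G) x} *
          ENNReal.ofReal (s ^ (p - 1)) := by gcongr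
      _ = 2 * (ENNReal.ofReal (s / 2) *
            μ {x | ENNReal.ofReal (s / 2) < dyadicMaximal μ ρ (T.indicator G) x}) *
          ENNReal.ofReal (s ^ (p - 1 - 1)) := by rw [hexp]; ring
      _ ≤ 2 * (D ^ 2 * ν T) * ENNReal.ofReal (s ^ (p - 1 - 1)) := by gcongr
      _ = _ := by ring
  have hp1 : 0 < p - 1 := by linarith
  have hlayer : ∫⁻ x, ENNReal.ofReal ((2 * g x) ^ (p - 1)) ∂ν =
      ENNReal.ofReal (p - 1) * ∫⁻ s in Set.Ioi (0 : ℝ), ν {x | s < 2 * g x} *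
        ENNReal.ofReal (s ^ (p - 1 - 1)) :=
    lintegral_rpow_eq_lintegral_meas_lt_mul ν
      (Eventually.of_forall fun x => by have := hg0 x; simp only [Pi.zero_apply]; positivity)
      (by fun_prop) hp1
  have hdens : ∫⁻ x, ENNReal.ofReal ((2 * g x) ^ (p - 1)) ∂ν =
      ENNReal.ofReal (2 ^ (p - 1)) * ∫⁻ x, ENNReal.ofReal (g x ^ p) ∂μ := by
    rw [hν, lintegral_withDensity_eq_lintegral_mul _ hGm (by fun_prop),
      ← lintegral_const_mul _ (by fun_prop)]
    refine lintegral_congr fun x => ?_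
    simp only [Pi.mul_apply, hG]
    rw [← ENNReal.ofReal_mul (hg0 x), ← ENNReal.ofReal_mul (by positivity),
      Real.mul_rpow zero_le_two (hg0 x)]
    congr 1
    rcases (hg0 x).eq_or_lt with h0 | h0
    · rw [← h0, Real.zero_rpow (by linarith), Real.zero_rpow (by linarith)]; ring
    · rw [Real.rpow_sub_one h0.ne']; field_simp
  rw [lintegral_rpow_eq_lintegral_meas_lt_mul μ (Eventually.of_forall fun x => ENNReal.toReal_nonneg)
    (measurable_dyadicMaximal hGm).ennreal_toReal.aemeasurable (by linarith : 0 < p), mul_assoc]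
  gcongr
  have hconst : ∫⁻ s in Set.Ioi (0 : ℝ), ν {x | s < 2 * g x} * ENNReal.ofReal (s ^ (p - 1 - 1)) =
      (ENNReal.ofReal (p - 1))⁻¹ * (ENNReal.ofReal (2 ^ (p - 1)) *
        ∫⁻ x, ENNReal.ofReal (g x ^ p) ∂μ) := by
    rw [← hdens, hlayer, ← mul_assoc, ENNReal.inv_mul_cancel (by simpa using hp)
      ENNReal.ofReal_ne_top, one_mul]
  rw [mul_assoc (2 * D ^ 2), mul_assoc (ENNReal.ofReal (p - 1))⁻¹, ← hconst, ← lintegral_const_mul' _ _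
    (by have := h.ne_top; finiteness)]
  exact setLIntegral_mono' measurableSet_Ioi fun s hs => level s hs

end DyadicMaximal

/-! ### Hedberg's argument -/

/-- Interpolation of a dyadic sum between a constant bound and a geometrically growing one. -/
theorem exists_sum_div_two_pow_le {τ : ℝ} (hτ : 1 < τ) :
    ∃ C : ℝ, 0 < C ∧ ∀ (n : ℕ) (a : ℕ → ℝ) (M L : ℝ), 0 ≤ M → 0 ≤ L → (∀ i, a i ≤ M) →
      (∀ i, a i ≤ (2 ^ i : ℝ) ^ τ * L) →
      ∑ i ∈ Finset.range n, a i / 2 ^ i ≤ C * (M ^ (1 - 1 / τ) * L ^ (1 / τ)) := by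
  set σ := τ - 1 with hσ
  have hσ0 : 0 < σ := by linarith
  set q : ℝ := (2 : ℝ) ^ (-σ) with hq
  have hq0 : 0 < q := by positivity
  have hq1 : q < 1 := Real.rpow_lt_one_of_one_lt_of_neg (by norm_num) (by linarith)
  refine ⟨(1 - q)⁻¹ + 2, by have := sub_pos.2 hq1; positivity, fun n a M L hM hL h1 h2 => ?_⟩
  have hC : 0 ≤ (1 - q)⁻¹ := by have := sub_pos.2 hq1; positivity
  by_cases hML : M = 0 ∨ L = 0
  · refine (Finset.sum_nonpos fun i _ => div_nonpos_of_nonpos_of_nonneg ?_ (by positivity)).trans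
      (by positivity)
    rcases hML with h | h
    · exact (h1 i).trans h.le
    · simpa [h] using h2 i
  push Not at hML
  have hM' : 0 < M := hM.lt_of_ne' hML.1
  have hL' : 0 < L := hL.lt_of_ne' hML.2
  -- `Y` is the scale at which the two bounds agree, `L Y^τ = M`. Below it the growing bound is
  -- used, above it the constant one, so the terms decay geometrically on both sides from the common
  -- value `W = M / Y`.
  set Y : ℝ := (M / L) ^ (1 / τ) with hY
  have hY0 : 0 < Y := by positivity
  have hYτ : L * Y ^ τ = M := by
    rw [hY, ← Real.rpow_mul (by positivity), one_div_mul_cancel (by linarith), Real.rpow_one]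
    field_simp
  set W : ℝ := L * Y ^ σ with hW
  have hWY : W * Y = M := by
    rw [← hYτ, hW, mul_assoc, ← Real.rpow_add_one hY0.ne', hσ]; simp
  have hWe : M ^ (1 - 1 / τ) * L ^ (1 / τ) = W := by
    rw [hW, hY, ← Real.rpow_mul (by positivity), Real.div_rpow hM hL]
    have e1 : 1 / τ * σ = 1 - 1 / τ := by rw [hσ]; field_simp
    have e2 : L = L ^ (1 - 1 / τ) * L ^ (1 / τ) := by
      rw [← Real.rpow_add hL']; simp
    rw [e1]
    nth_rewrite 2 [e2]
    field_simp
  have hex : ∃ k : ℕ, Y < 2 ^ k := pow_unbounded_of_one_lt Y one_lt_two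
  classical
  set k := Nat.find hex with hk
  have hkY : Y < 2 ^ k := Nat.find_spec hex
  have hW0 : 0 < W := by positivity
  have hterm : ∀ i, a i / 2 ^ i ≤ W * (if i < k then q ^ (k - 1 - i) else (1 / 2) ^ (i - k)) := by
    intro i
    split_ifs with hik
    -- Here `i < k` forces `k ≥ 1`, so `k - 1` is a true predecessor and minimality of `k` applies.
    · have hkm : (2 : ℝ) ^ (k - 1) ≤ Y := not_lt.1 (Nat.find_min hex (m := k - 1) (by omega))
      have e1 : a i / 2 ^ i ≤ (2 ^ i : ℝ) ^ σ * L := by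
        rw [div_le_iff₀ (by positivity)]
        refine (h2 i).trans_eq ?_
        rw [hσ, Real.rpow_sub_one (by positivity)]
        field_simp
      have e2 : (2 ^ (k - 1) : ℝ) = 2 ^ i * 2 ^ (k - 1 - i) := by rw [← pow_add]; congr 1; omega
      have e3 : q ^ (k - 1 - i) = ((2 : ℝ) ^ (k - 1 - i)) ^ (-σ) := by
        rw [hq, ← Real.rpow_natCast, ← Real.rpow_mul zero_le_two, mul_comm,
          Real.rpow_mul zero_le_two, Real.rpow_natCast]
      calc a i / 2 ^ i ≤ (2 ^ i : ℝ) ^ σ * L := e1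
        _ = L * (2 ^ (k - 1) : ℝ) ^ σ * q ^ (k - 1 - i) := by
            rw [e2, e3, Real.mul_rpow (by positivity) (by positivity), Real.rpow_neg (by positivity)]
            field_simp
        _ ≤ L * Y ^ σ * q ^ (k - 1 - i) := by gcongr
    · have e2 : (2 ^ i : ℝ) = 2 ^ k * 2 ^ (i - k) := by rw [← pow_add]; congr 1; omega
      calc a i / 2 ^ i ≤ M / 2 ^ i := by gcongr; exact h1 i
        _ = W * (Y / 2 ^ k * (1 / 2) ^ (i - k)) := by rw [e2, ← hWY]; simp; field_simp
        _ ≤ W * (1 * (1 / 2) ^ (i - k)) := by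
            gcongr
            exact (div_le_one (by positivity)).2 hkY.le
        _ = _ := by rw [one_mul]
  have hgeom : ∑ i ∈ Finset.range n, (if i < k then q ^ (k - 1 - i) else (1 / 2 : ℝ) ^ (i - k)) ≤
      (1 - q)⁻¹ + 2 := by
    calc _ ≤ ∑ i ∈ Finset.range (k + n), (if i < k then q ^ (k - 1 - i) else (1 / 2 : ℝ) ^ (i - k)) :=
          Finset.sum_le_sum_of_subset_of_nonneg (Finset.range_mono (by omega))
            fun i _ _ => by split_ifs <;> positivity
      _ = ∑ i ∈ Finset.range k, q ^ i + ∑ i ∈ Finset.range n, (1 / 2 : ℝ) ^ i := by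
          rw [Finset.sum_range_add, ← Finset.sum_range_reflect (fun i => q ^ i)]
          congr 1
          · exact Finset.sum_congr rfl fun i hi => if_pos (Finset.mem_range.1 hi)
          · exact Finset.sum_congr rfl fun i _ => by simp
      _ ≤ _ := by
          gcongr
          · exact ((summable_geometric_of_lt_one hq0.le hq1).sum_le_tsum _
              fun i _ => by positivity).trans_eq (tsum_geometric_of_lt_one hq0.le hq1)
          · exact (summable_geometric_two.sum_le_tsum _
              fun i _ => by positivity).trans_eq tsum_geometric_two
  rw [hWe]
  calc _ ≤ ∑ i ∈ Finset.range n, W * (if i < k then q ^ (k - 1 - i) else (1 / 2) ^ (i - k)) :=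
        Finset.sum_le_sum fun i _ => hterm i
    _ = W * ∑ i ∈ Finset.range n, (if i < k then q ^ (k - 1 - i) else (1 / 2) ^ (i - k)) :=
        Finset.mul_sum _ _ _ |>.symm
    _ ≤ W * ((1 - q)⁻¹ + 2) := by gcongr
    _ = _ := mul_comm _ _

section Hedberg

open Metric
open scoped ENNReal

variable {α : Type*} [PseudoMetricSpace α] [MeasurableSpace α] {μ : Measure α} {D : ℝ≥0∞} {ρ : ℝ}

theorem IsDoublingWith.measure_ball_le_pow (h : IsDoublingWith μ D) (hρ : 0 < ρ) (x : α) (i : ℕ) :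
    μ (ball x ρ) ≤ D ^ i * μ (ball x (ρ / 2 ^ i)) := by
  induction i with
  | zero => simp
  | succ i ih =>
    refine ih.trans ?_
    rw [pow_succ, mul_assoc]
    gcongr
    refine le_trans (le_of_eq ?_) (h.doubling x (ρ / 2 ^ (i + 1)) (by positivity))
    congr 2
    rw [pow_succ]
    field_simp

/-- The average over a small ball is controlled by the global `L^p` norm. -/
theorem IsDoublingWith.average_le_of_le_measure_ball (h : IsDoublingWith μ D) (hρ : 0 < ρ) {p : ℝ}
    (hp : 1 < p) {c : ℝ≥0∞} (hc0 : c ≠ 0) (hc : c ≠ ⊤) {g : α → ℝ≥0∞} (hg : Measurable g) {x : α}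
    (hx : c ≤ μ (ball x ρ)) (i : ℕ) :
    (μ (ball x (ρ / 2 ^ i)))⁻¹ * ∫⁻ y in ball x (ρ / 2 ^ i), g y ∂μ ≤
      (D ^ i) ^ (1 / p) * (c⁻¹ * ∫⁻ y, g y ^ p ∂μ) ^ (1 / p) := by
  set B := ball x (ρ / 2 ^ i) with hB
  have hB0 : μ B ≠ 0 := h.pos x _ (by positivity)
  have hB1 : μ B ≠ ⊤ := h.fin x _ (by positivity)
  have hp0 : 0 < 1 / p := by positivity
  have hconj : p.HolderConjugate (p / (p - 1)) := Real.HolderConjugate.conjExponent hp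
  have hol := ENNReal.lintegral_mul_le_Lp_mul_Lq (μ.restrict B) hconj hg.aemeasurable
    (measurable_const (a := (1 : ℝ≥0∞))).aemeasurable
  simp only [Pi.mul_apply, mul_one, ENNReal.one_rpow, lintegral_one, Measure.restrict_apply_univ]
    at hol
  -- Doubling `i` times compares `B` with the ball of radius `ρ`, whose measure is at least `c`;
  -- this is where the dimension `Q` enters.
  have hinv : (μ B)⁻¹ ≤ D ^ i * c⁻¹ := by
    have h1 : c ≤ D ^ i * μ B := hx.trans (h.measure_ball_le_pow hρ x i)
    rw [← div_eq_mul_inv, ENNReal.le_div_iff_mul_le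
      (Or.inl hc0) (Or.inl hc), mul_comm, ← div_eq_mul_inv]
    exact ENNReal.div_le_of_le_mul h1
  calc (μ B)⁻¹ * ∫⁻ y in B, g y ∂μ
      ≤ (μ B)⁻¹ * ((∫⁻ y in B, g y ^ p ∂μ) ^ (1 / p) * μ B ^ (1 / (p / (p - 1)))) := by gcongr
    _ = ((μ B)⁻¹ * ∫⁻ y in B, g y ^ p ∂μ) ^ (1 / p) := by
        have e : (μ B)⁻¹ = (μ B)⁻¹ ^ (1 / p) * (μ B)⁻¹ ^ (1 / (p / (p - 1))) := by
          rw [← ENNReal.rpow_add_of_nonneg _ _ hp0.le hconj.symm.one_div_nonneg]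
          rw [one_div, one_div, hconj.inv_add_inv_eq_one, ENNReal.rpow_one]
        nth_rewrite 1 [e]
        rw [ENNReal.mul_rpow_of_nonneg _ _ hp0.le]
        have e2 : (μ B)⁻¹ ^ (1 / (p / (p - 1))) * μ B ^ (1 / (p / (p - 1))) = 1 := by
          rw [← ENNReal.mul_rpow_of_nonneg _ _ hconj.symm.one_div_nonneg,
            ENNReal.inv_mul_cancel hB0 hB1, ENNReal.one_rpow]
        calc _ = (μ B)⁻¹ ^ (1 / p) * (∫⁻ y in B, g y ^ p ∂μ) ^ (1 / p) *
              ((μ B)⁻¹ ^ (1 / (p / (p - 1))) * μ B ^ (1 / (p / (p - 1)))) := by ring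
          _ = _ := by rw [e2, mul_one]
    _ ≤ (D ^ i * c⁻¹ * ∫⁻ y, g y ^ p ∂μ) ^ (1 / p) := by
        gcongr
        exact Measure.restrict_le_self
    _ = _ := by rw [mul_assoc, ENNReal.mul_rpow_of_nonneg _ _ hp0.le]

variable [SecondCountableTopology α] [OpensMeasurableSpace α]

/-- Hedberg's argument: a function that is controlled by the dyadic Riesz potential of `g` satisfies
the Sobolev inequality. -/
theorem IsDoublingWith.exists_sobolev_of_le_potential [SFinite μ] {Q p : ℝ}
    (h : IsDoublingWith μ (ENNReal.ofReal (2 ^ Q)))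
    (hp : 1 < p) (hpQ : p < Q) (hρ : 0 < ρ) {K : ℝ} (hK : 0 ≤ K) {c : ℝ≥0∞} (hc0 : c ≠ 0)
    (hc : c ≠ ⊤) {Ω : Set α} (hΩm : MeasurableSet Ω) (hΩ : ∀ x ∈ Ω, c ≤ μ (ball x ρ)) :
    ∃ S : ℝ≥0∞, S ≠ ⊤ ∧ ∀ (φ g : α → ℝ), Measurable g → (∀ x, 0 ≤ g x) → (∃ B, ∀ x, g x ≤ B) →
      ∫⁻ x, ENNReal.ofReal (g x ^ p) ∂μ ≠ ⊤ →
      (∀ x ∈ Ω, ∀ ε > 0, ∃ n : ℕ, |φ x| ≤ ε + K * ∑ i ∈ Finset.range n,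
        (⨍ y in ball x (ρ / 2 ^ i), g y ∂μ) / 2 ^ i) →
      ∫⁻ x in Ω, ENNReal.ofReal (|φ x| ^ sobolevExponent Q p) ∂μ ≤
        S * (∫⁻ x, ENNReal.ofReal (g x ^ p) ∂μ) ^ (sobolevExponent Q p / p) := by
  have hp0 : 0 < p := by linarith
  have hQ0 : 0 < Q := by linarith
  have hQp : 0 < Q - p := by linarith
  -- With `D = 2^Q`, the Hölder bound on the `i`-th average grows like `D^{i/p} = (2^i)^{Q/p}`; the
  -- condition `τ > 1` is exactly `p < Q`.
  obtain ⟨C, hC, hsum⟩ := exists_sum_div_two_pow_le (τ := Q / p) ((one_lt_div hp0).2 hpQ)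
  obtain ⟨CM, hCM, hmax⟩ := h.exists_lintegral_dyadicMaximal_rpow_le hρ hp
  set r := sobolevExponent Q p with hr
  have hr0 : 0 < r := by rw [hr, sobolevExponent]; positivity
  refine ⟨ENNReal.ofReal ((K * C) ^ r) * (c⁻¹ ^ (r / Q) * CM), ?_, ?_⟩
  · have : c⁻¹ ^ (r / Q) ≠ ⊤ := ENNReal.rpow_ne_top_of_nonneg (by positivity) (by simpa using hc0)
    finiteness
  rintro φ g hg hg0 ⟨B, hB⟩ hI hφ
  set I := ∫⁻ x, ENNReal.ofReal (g x ^ p) ∂μ with hIdef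
  set G : α → ℝ≥0∞ := fun y => ENNReal.ofReal (g y) with hG
  have hGm : Measurable G := hg.ennreal_ofReal
  have hGI : ∫⁻ y, G y ^ p ∂μ = I := lintegral_congr fun y => by
    rw [hG, ENNReal.ofReal_rpow_of_nonneg (hg0 y) hp0.le]
  set M : α → ℝ := fun x => (dyadicMaximal μ ρ G x).toReal with hM
  have hMtop : ∀ x, dyadicMaximal μ ρ G x ≠ ⊤ := fun x => ne_top_of_le_ne_top ENNReal.ofReal_ne_top
    (h.dyadicMaximal_le hρ (c := ENNReal.ofReal B) (fun y => ENNReal.ofReal_le_ofReal (hB y)) x)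
  set L : ℝ := ((c⁻¹ * I) ^ (1 / p)).toReal with hL
  have hLtop : (c⁻¹ * I) ^ (1 / p) ≠ ⊤ := ENNReal.rpow_ne_top_of_nonneg (by positivity)
    (ENNReal.mul_ne_top (by simpa using hc0) hI)
  have havg : ∀ x i, ⨍ y in ball x (ρ / 2 ^ i), g y ∂μ =
      ((μ (ball x (ρ / 2 ^ i)))⁻¹ * ∫⁻ y in ball x (ρ / 2 ^ i), G y ∂μ).toReal := by
    intro x i
    rw [setAverage_eq, integral_eq_lintegral_of_nonneg_ae (Eventually.of_forall hg0)
      hg.aestronglyMeasurable, ENNReal.toReal_mul, ENNReal.toReal_inv, Measure.real, smul_eq_mul]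
  have hpt : ∀ x ∈ Ω, |φ x| ≤ K * C * (M x ^ (1 - 1 / (Q / p)) * L ^ (1 / (Q / p))) := by
    intro x hx
    refine le_of_forall_pos_le_add fun ε hε => ?_
    obtain ⟨n, hn⟩ := hφ x hx ε hε
    refine hn.trans ?_
    rw [add_comm, mul_assoc]
    gcongr
    refine hsum n _ _ _ ENNReal.toReal_nonneg ENNReal.toReal_nonneg (fun i => ?_) fun i => ?_
    · rw [havg]
      exact ENNReal.toReal_mono (hMtop x) (average_le_dyadicMaximal x i)
    · rw [havg]
      have h1 := h.average_le_of_le_measure_ball hρ hp hc0 hc hGm (hΩ x hx) i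
      rw [hGI] at h1
      have h2 : ((2 ^ i : ℝ) ^ (Q / p)) = ((ENNReal.ofReal (2 ^ Q) ^ i) ^ (1 / p)).toReal := by
        rw [← ENNReal.ofReal_pow (by positivity), ENNReal.ofReal_rpow_of_nonneg (by positivity)
          (by positivity), ENNReal.toReal_ofReal (by positivity), ← Real.rpow_natCast,
          ← Real.rpow_natCast, ← Real.rpow_mul (by positivity), ← Real.rpow_mul (by positivity),
          ← Real.rpow_mul (by positivity)]
        congr 1
        ring
      rw [h2, hL, ← ENNReal.toReal_mul]
      exact ENNReal.toReal_mono (ENNReal.mul_ne_top (ENNReal.rpow_ne_top_of_nonneg (by positivity)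
        (by finiteness)) hLtop) h1
  -- The Sobolev exponent is the one for which the `r`-th power of the pointwise bound contains `M`
  -- to the power `p`, as the maximal theorem requires.
  have e1 : (1 - 1 / (Q / p)) * r = p := by rw [hr, sobolevExponent]; field_simp
  have e2 : 1 / (Q / p) * r = p * (r / Q) := by field_simp
  have e3 : 1 + r / Q = r / p := by rw [hr, sobolevExponent]; field_simp; ring
  have hpow : ∀ x ∈ Ω, ENNReal.ofReal (|φ x| ^ r) ≤
      ENNReal.ofReal ((K * C) ^ r) * (c⁻¹ * I) ^ (r / Q) * ENNReal.ofReal (M x ^ p) := by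
    intro x hx
    have hMx : 0 ≤ M x := ENNReal.toReal_nonneg
    have hL0 : 0 ≤ L := ENNReal.toReal_nonneg
    have h1 : |φ x| ^ r ≤ (K * C) ^ r * L ^ (p * (r / Q)) * M x ^ p := by
      calc |φ x| ^ r ≤ (K * C * (M x ^ (1 - 1 / (Q / p)) * L ^ (1 / (Q / p)))) ^ r :=
            Real.rpow_le_rpow (abs_nonneg _) (hpt x hx) hr0.le
        _ = _ := by
            rw [Real.mul_rpow (x := K * C) (by positivity) (by positivity),
              Real.mul_rpow (x := M x ^ _) (by positivity) (by positivity), ← Real.rpow_mul hMx, ← Real.rpow_mul hL0, e1, e2]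
            ring
    refine (ENNReal.ofReal_le_ofReal h1).trans_eq ?_
    rw [ENNReal.ofReal_mul (by positivity), ENNReal.ofReal_mul (by positivity)]
    congr 2
    rw [hL, ← ENNReal.ofReal_rpow_of_nonneg ENNReal.toReal_nonneg (by positivity),
      ENNReal.ofReal_toReal hLtop, ← ENNReal.rpow_mul]
    congr 1
    field_simp
  calc ∫⁻ x in Ω, ENNReal.ofReal (|φ x| ^ r) ∂μ
      ≤ ∫⁻ x in Ω, ENNReal.ofReal ((K * C) ^ r) * (c⁻¹ * I) ^ (r / Q) *
          ENNReal.ofReal (M x ^ p) ∂μ := setLIntegral_mono' hΩm hpow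
    _ = ENNReal.ofReal ((K * C) ^ r) * (c⁻¹ * I) ^ (r / Q) *
          ∫⁻ x in Ω, ENNReal.ofReal (M x ^ p) ∂μ := lintegral_const_mul' _ _
        (ENNReal.mul_ne_top ENNReal.ofReal_ne_top (ENNReal.rpow_ne_top_of_nonneg (by positivity)
          (ENNReal.mul_ne_top (by simpa using hc0) hI)))
    _ ≤ ENNReal.ofReal ((K * C) ^ r) * (c⁻¹ * I) ^ (r / Q) * (CM * I) := by
        gcongr
        exact (setLIntegral_le_lintegral _ _).trans (hmax g hg hg0)
    _ = ENNReal.ofReal ((K * C) ^ r) * (c⁻¹ ^ (r / Q) * CM) * (I * I ^ (r / Q)) := by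
        rw [ENNReal.mul_rpow_of_nonneg _ _ (by positivity)]; ring
    _ = _ := by
        congr 1
        rw [← e3, ENNReal.rpow_add_of_nonneg _ _ zero_le_one (by positivity), ENNReal.rpow_one]

end Hedberg

/-! ### Comparison of averages -/

section Averages

variable {α : Type*} [MeasurableSpace α] {μ : Measure α} {B : Set α} {f : α → ℝ}

theorem abs_setAverage_sub_le (hB0 : μ B ≠ 0) (hB : μ B ≠ ⊤) (hf : IntegrableOn f B μ) (c : ℝ) :
    |(⨍ y in B, f y ∂μ) - c| ≤ ⨍ y in B, |f y - c| ∂μ := by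
  have hpos : 0 < μ.real B := ENNReal.toReal_pos hB0 hB
  have hc : IntegrableOn (fun _ => c) B μ := integrableOn_const hB
  have h1 : (⨍ y in B, f y ∂μ) - c = ⨍ y in B, (f y - c) ∂μ := by
    rw [setAverage_eq, setAverage_eq, integral_sub hf hc, setIntegral_const]
    simp only [smul_eq_mul]
    field_simp
  rw [h1, setAverage_eq, setAverage_eq, smul_eq_mul, smul_eq_mul, abs_mul,
    abs_of_pos (inv_pos.2 hpos)]
  gcongr
  exact abs_integral_le_integral_abs

theorem setAverage_le_mul_setAverage {A : Set α} {D : ℝ} (hD : 0 ≤ D) (hAB : A ⊆ B) (hA0 : μ A ≠ 0)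
    (hB : μ B ≠ ⊤) (hBA : μ B ≤ ENNReal.ofReal D * μ A) (hf : IntegrableOn f B μ)
    (hf0 : ∀ x, 0 ≤ f x) : ⨍ y in A, f y ∂μ ≤ D * ⨍ y in B, f y ∂μ := by
  have hA : μ A ≠ ⊤ := ne_top_of_le_ne_top hB (measure_mono hAB)
  have hApos : 0 < μ.real A := ENNReal.toReal_pos hA0 hA
  have hBpos : 0 < μ.real B := hApos.trans_le (measureReal_mono hAB hB)
  have h1 : μ.real B ≤ D * μ.real A := by
    have := ENNReal.toReal_mono (ENNReal.mul_ne_top ENNReal.ofReal_ne_top hA) hBA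
    rwa [ENNReal.toReal_mul, ENNReal.toReal_ofReal hD] at this
  rw [setAverage_eq, setAverage_eq, smul_eq_mul, smul_eq_mul, ← mul_assoc]
  have h2 : ∫ y in A, f y ∂μ ≤ ∫ y in B, f y ∂μ :=
    setIntegral_mono_set hf (Eventually.of_forall hf0) (LE.le.eventuallyLE hAB)
  have h3 : 0 ≤ ∫ y in A, f y ∂μ := integral_nonneg hf0
  gcongr
  rw [← div_eq_mul_inv, inv_le_iff_one_le_mul₀ hApos]
  rw [div_mul_eq_mul_div, one_le_div hBpos]
  exact h1

/-- A function vanishing on at least half of `B` has an average controlled by its oscillation. -/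
theorem abs_setAverage_le_two_mul {Z : Set α} (hB0 : μ B ≠ 0) (hB : μ B ≠ ⊤) (hBm : MeasurableSet B) (hZ : MeasurableSet Z)
    (hZB : 2 * μ Z ≤ μ B) (hfZ : ∀ x ∉ Z, f x = 0) (hf : IntegrableOn f B μ) :
    |⨍ y in B, f y ∂μ| ≤ 2 * ⨍ y in B, |f y - ⨍ z in B, f z ∂μ| ∂μ := by
  set a := ⨍ y in B, f y ∂μ with ha
  have hpos : 0 < μ.real B := ENNReal.toReal_pos hB0 hB
  have hint : IntegrableOn (fun y => |f y - a|) B μ := (hf.sub (integrableOn_const hB)).abs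
  have h1 : ∫ y in B \ Z, |f y - a| ∂μ ≤ ∫ y in B, |f y - a| ∂μ :=
    setIntegral_mono_set hint (Eventually.of_forall fun _ => abs_nonneg _)
      (LE.le.eventuallyLE Set.sdiff_subset)
  -- Off `Z` the oscillation is exactly `|a|`, and `B \ Z` carries at least half of the measure of
  -- `B`.
  have h2 : ∫ y in B \ Z, |f y - a| ∂μ = μ.real (B \ Z) * |a| := by
    rw [setIntegral_congr_fun (g := fun _ => |a|) (hBm.diff hZ) fun y hy => by simp [hfZ y hy.2],
      setIntegral_const, smul_eq_mul]
  have hZr : 2 * μ.real Z ≤ μ.real B := by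
    have := ENNReal.toReal_mono hB hZB
    rwa [ENNReal.toReal_mul, ENNReal.toReal_ofNat] at this
  have hZtop : μ Z ≠ ⊤ := by
    rintro h
    rw [h] at hZB
    exact hB (top_le_iff.1 ((le_of_eq (by simp)).trans hZB))
  have h3 : μ.real B ≤ μ.real (B \ Z) + μ.real Z := by
    refine (measureReal_mono (s₂ := B \ Z ∪ Z) (by simp)
      (measure_union_ne_top (ne_top_of_le_ne_top hB (measure_mono Set.sdiff_subset)) hZtop)).trans
      (measureReal_union_le _ _)
  rw [setAverage_eq _ (fun y => |f y - a|), smul_eq_mul, ← mul_assoc, ← div_eq_mul_inv,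
    div_mul_eq_mul_div, le_div_iff₀ hpos]
  have h4 : 0 ≤ |a| := abs_nonneg a
  nlinarith

end Averages

/-! ### The Sobolev inequality in doubling spaces -/

section Sobolev

open Metric
open scoped ENNReal

variable {α : Type*} [PseudoMetricSpace α] [MeasurableSpace α] {μ : Measure α}

/-- Local finiteness gives one finite ball around each point, and doubling passes finiteness on to
all larger radii. -/
theorem IsDoublingWith.of_isLocallyFiniteMeasure [IsLocallyFiniteMeasure μ] {D : ℝ≥0∞}
    (hD : D ≠ ⊤) (hpos : ∀ x r, 0 < r → μ (ball x r) ≠ 0)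
    (h : ∀ x r, 0 < r → μ (ball x (2 * r)) ≤ D * μ (ball x r)) : IsDoublingWith μ D where
  ne_top := hD
  pos := hpos
  doubling := h
  fin x r _ := by
    obtain ⟨s, hs, hsfin⟩ := μ.finiteAt_nhds x
    obtain ⟨ε, hε, hεs⟩ := Metric.mem_nhds_iff.1 hs
    have key : ∀ n : ℕ, μ (ball x (2 ^ n * ε)) ≠ ⊤ := by
      intro n
      induction n with
      | zero => simpa using ne_top_of_le_ne_top hsfin.ne (measure_mono hεs)
      | succ n ih =>
        rw [pow_succ', mul_assoc]
        exact ne_top_of_le_ne_top (ENNReal.mul_ne_top hD ih) (h x _ (by positivity))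
    obtain ⟨n, hn⟩ := pow_unbounded_of_one_lt (r / ε) one_lt_two
    rw [div_lt_iff₀ hε] at hn
    exact ne_top_of_le_ne_top (key n) (measure_mono (ball_subset_ball hn.le))

variable [OpensMeasurableSpace α]

/-- The telescoping argument along dyadic balls. -/
theorem IsDoublingWith.abs_le_dyadic_potential {Q : ℝ}
    (h : IsDoublingWith μ (ENNReal.ofReal (2 ^ Q))) {R ν C_P : ℝ} (hR : 0 < R)
    {Ω : Set α} (hΩ : MeasurableSet Ω) {x : α} (hx : 2 * μ Ω ≤ μ (ball x R))
    {φ g : α → ℝ} (hφ : Continuous φ) (hφΩ : ∀ y ∉ Ω, φ y = 0) (hφB : ∃ B, ∀ y, |φ y| ≤ B)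
    (hg0 : ∀ y, 0 ≤ g y)
    (hP : ∀ r, 0 < r → ⨍ y in ball x r, |φ y - ⨍ z in ball x r, φ z ∂μ| ∂μ ≤
      C_P * r * ⨍ y in ball x (ν * r), g y ∂μ) {ε : ℝ} (hε : 0 < ε) :
    ∃ n : ℕ, |φ x| ≤ ε + (2 + 2 ^ Q) * C_P * R * ∑ i ∈ Finset.range n,
        (⨍ y in ball x (ν * R / 2 ^ i), g y ∂μ) / 2 ^ i := by
  obtain ⟨B, hB⟩ := hφB
  set s : ℕ → Set α := fun i => ball x (R / 2 ^ i) with hs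
  have hs0 : ∀ i, μ (s i) ≠ 0 := fun i => h.pos x _ (by positivity)
  have hs1 : ∀ i, μ (s i) ≠ ⊤ := fun i => h.fin x _ (by positivity)
  have hint : ∀ i, IntegrableOn φ (s i) μ := fun i =>
    Measure.integrableOn_of_bounded (hs1 i) hφ.measurable.aestronglyMeasurable
      (M := B) (Eventually.of_forall fun y => hB y)
  set a : ℕ → ℝ := fun i => ⨍ y in s i, φ y ∂μ with ha
  set P : ℕ → ℝ := fun i => ⨍ y in s i, |φ y - a i| ∂μ with hPdef
  set A : ℕ → ℝ := fun i => (⨍ y in ball x (ν * R / 2 ^ i), g y ∂μ) / 2 ^ i with hA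
  have hA0 : ∀ i, 0 ≤ A i := fun i => by
    refine div_nonneg ?_ (by positivity)
    rw [setAverage_eq]
    exact mul_nonneg (by positivity) (integral_nonneg hg0)
  have hPA : ∀ i, P i ≤ C_P * R * A i := by
    intro i
    refine (hP (R / 2 ^ i) (by positivity)).trans_eq ?_
    simp only [hA]
    rw [mul_div_assoc ν R]
    ring
  have hP0 : ∀ i, 0 ≤ P i := fun i => by
    simp only [hPdef]
    rw [setAverage_eq]
    exact mul_nonneg (by positivity) (integral_nonneg fun _ => abs_nonneg _)
  have hstep : ∀ i, |a (i + 1) - a i| ≤ 2 ^ Q * P i := by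
    intro i
    have e : R / 2 ^ i = 2 * (R / 2 ^ (i + 1)) := by rw [pow_succ]; field_simp
    have hsub : s (i + 1) ⊆ s i := ball_subset_ball (by
      rw [e]; linarith [show 0 < R / 2 ^ (i + 1) by positivity])
    refine (abs_setAverage_sub_le (hs0 _) (hs1 _) (hint _) _).trans ?_
    refine setAverage_le_mul_setAverage (f := fun y => |φ y - a i|) (by positivity) hsub (hs0 _)
      (hs1 _) ?_ ((hint i).sub (integrableOn_const (hs1 i))).abs fun _ => abs_nonneg _
    simp only [hs]
    rw [e]
    exact h.doubling x _ (by positivity)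
  have h0 : |a 0| ≤ 2 * P 0 :=
    abs_setAverage_le_two_mul (hs0 0) (hs1 0) measurableSet_ball hΩ (by simpa [hs] using hx)
      hφΩ (hint 0)
  have hbound : ∀ n, |a n| ≤ 2 * P 0 + 2 ^ Q * ∑ i ∈ Finset.range n, P i := by
    intro n
    induction n with
    | zero => simpa using h0
    | succ n ih =>
      rw [Finset.sum_range_succ, mul_add]
      have := abs_sub_abs_le_abs_sub (a (n + 1)) (a n)
      linarith [hstep n]
  obtain ⟨η, hη, hηε⟩ := Metric.continuousAt_iff.1 hφ.continuousAt ε hε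
  obtain ⟨n, hn⟩ := pow_unbounded_of_one_lt (R / η) one_lt_two
  -- The sum over `n + 1` terms contains `P 0`, which bounds the first average, even when `n = 0`.
  refine ⟨n + 1, ?_⟩
  have hRn : R / 2 ^ n ≤ η := by
    rw [div_lt_iff₀ hη] at hn
    rw [div_le_iff₀ (by positivity)]
    linarith
  have hlim : |a n - φ x| ≤ ε := by
    refine (abs_setAverage_sub_le (hs0 n) (hs1 n) (hint n) (φ x)).trans ?_
    have hpos : 0 < μ.real (s n) := ENNReal.toReal_pos (hs0 n) (hs1 n)
    rw [setAverage_eq, smul_eq_mul, inv_mul_le_iff₀ hpos]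
    have : ∫ y in s n, |φ y - φ x| ∂μ ≤ ∫ y in s n, ε ∂μ := by
      refine setIntegral_mono_on ((hint n).sub (integrableOn_const (hs1 n))).abs
        (integrableOn_const (hs1 n)) measurableSet_ball fun y hy => ?_
      exact (hηε (lt_of_lt_of_le (mem_ball.1 hy) hRn)).le
    rwa [setIntegral_const, smul_eq_mul] at this
  have hPn : P 0 ≤ ∑ i ∈ Finset.range (n + 1), P i :=
    Finset.single_le_sum (fun i _ => hP0 i) (by simp)
  have hPn' : ∑ i ∈ Finset.range n, P i ≤ ∑ i ∈ Finset.range (n + 1), P i :=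
    Finset.sum_le_sum_of_subset_of_nonneg (Finset.range_mono (by omega)) fun i _ _ => hP0 i
  have hPA' : ∑ i ∈ Finset.range (n + 1), P i ≤ C_P * R * ∑ i ∈ Finset.range (n + 1), A i := by
    rw [Finset.mul_sum]
    exact Finset.sum_le_sum fun i _ => hPA i
  calc |φ x| ≤ |a n - φ x| + |a n| := by
        have := abs_sub_abs_le_abs_sub (φ x) (a n)
        rw [abs_sub_comm] at this
        linarith
    _ ≤ ε + (2 * P 0 + 2 ^ Q * ∑ i ∈ Finset.range n, P i) := add_le_add hlim (hbound n)
    _ ≤ ε + (2 * ∑ i ∈ Finset.range (n + 1), P i + 2 ^ Q * ∑ i ∈ Finset.range (n + 1), P i) := by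
        gcongr
    _ = ε + (2 + 2 ^ Q) * ∑ i ∈ Finset.range (n + 1), P i := by ring
    _ ≤ ε + (2 + 2 ^ Q) * (C_P * R * ∑ i ∈ Finset.range (n + 1), A i) := by gcongr
    _ = _ := by ring

/-- The Sobolev inequality in a doubling space, for functions supported in a bounded open set that
satisfy a Poincaré inequality on balls. -/
theorem IsDoublingWith.exists_sobolev [SecondCountableTopology α] [SFinite μ] {Q p : ℝ}
    (h : IsDoublingWith μ (ENNReal.ofReal (2 ^ Q))) (hμ : μ Set.univ = ⊤)
    (hp : 1 < p) (hpQ : p < Q) {ν C_P : ℝ} (hν : 0 < ν) (hCP : 0 < C_P)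
    {Ω : Set α} (hΩ : IsOpen Ω) (hΩb : Bornology.IsBounded Ω) :
    ∃ S : ℝ≥0∞, S ≠ ⊤ ∧ ∀ (φ g : α → ℝ), Continuous φ → (∀ y ∉ Ω, φ y = 0) →
      (∃ B, ∀ y, |φ y| ≤ B) → Measurable g → (∀ x, 0 ≤ g x) → (∃ B, ∀ x, g x ≤ B) →
      ∫⁻ x, ENNReal.ofReal (g x ^ p) ∂μ ≠ ⊤ →
      (∀ x r, 0 < r → ⨍ y in ball x r, |φ y - ⨍ z in ball x r, φ z ∂μ| ∂μ ≤
        C_P * r * ⨍ y in ball x (ν * r), g y ∂μ) →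
      ∫⁻ x in Ω, ENNReal.ofReal (|φ x| ^ sobolevExponent Q p) ∂μ ≤
        S * (∫⁻ x, ENNReal.ofReal (g x ^ p) ∂μ) ^ (sobolevExponent Q p / p) := by
  rcases Ω.eq_empty_or_nonempty with rfl | ⟨x₀, hx₀⟩
  · exact ⟨0, by simp, by simp⟩
  obtain ⟨d, hd⟩ := hΩb.subset_ball x₀
  have hd0 : 0 < d := by simpa using pos_of_mem_ball (hd hx₀)
  have hΩtop : μ Ω ≠ ⊤ := ne_top_of_le_ne_top (h.fin x₀ d hd0) (measure_mono hd)
  have hΩ0 : μ Ω ≠ 0 := by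
    obtain ⟨ε, hε, hεs⟩ := Metric.isOpen_iff.1 hΩ x₀ hx₀
    exact fun h0 => h.pos x₀ ε hε (measure_mono_null hεs h0)
  have hball : ∀ {x s}, x ∈ Ω → ball x₀ s ⊆ ball x (s + d) := fun {x s} hx =>
    ball_subset_ball' (by have := mem_ball.1 (hd hx); rw [dist_comm] at this; linarith)
  -- Infinite total mass provides a ball of which `Ω` fills less than half. The radius `R = n + d`
  -- makes every `ball x R` with `x ∈ Ω` contain it.
  obtain ⟨n, hn⟩ : ∃ n : ℕ, 2 * μ Ω < μ (ball x₀ n) := by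
    have h1 : Tendsto (fun n : ℕ => μ (ball x₀ n)) atTop (𝓝 (μ (⋃ n : ℕ, ball x₀ n))) :=
      tendsto_measure_iUnion_atTop fun m n hmn => ball_subset_ball (by exact_mod_cast hmn)
    rw [iUnion_ball_nat, hμ] at h1
    exact (h1.eventually (lt_mem_nhds (by finiteness : 2 * μ Ω < ⊤))).exists
  set R : ℝ := n + d with hRdef
  have hR : 0 < R := by positivity
  -- After `k` doublings, `ball x (ν * R)` contains `Ω` for every `x ∈ Ω`, which gives the uniform
  -- lower bound `μ Ω / D ^ k`.
  obtain ⟨k, hk⟩ := pow_unbounded_of_one_lt ((d + d) / (ν * R)) one_lt_two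
  have hk' : d + d ≤ ν * R * 2 ^ k := by
    rw [div_lt_iff₀ (by positivity)] at hk
    linarith
  set D := ENNReal.ofReal (2 ^ Q) with hD
  have hD0 : D ≠ 0 := by simp only [hD, ne_eq, ENNReal.ofReal_eq_zero, not_le]; positivity
  have hc : ∀ x ∈ Ω, μ Ω / D ^ k ≤ μ (ball x (ν * R)) := by
    intro x hx
    refine ENNReal.div_le_of_le_mul' ?_
    have h1 := h.measure_ball_le_pow (ρ := ν * R * 2 ^ k) (by positivity) x k
    rw [mul_div_cancel_right₀ _ (by positivity)] at h1
    exact (measure_mono (hd.trans ((hball hx).trans (ball_subset_ball hk')))).trans h1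
  obtain ⟨S, hS, H⟩ := h.exists_sobolev_of_le_potential hp hpQ (ρ := ν * R) (by positivity)
    (K := (2 + 2 ^ Q) * C_P * R) (by positivity) (c := μ Ω / D ^ k)
    (ENNReal.div_ne_zero.2 ⟨hΩ0, by finiteness⟩) (ENNReal.div_ne_top hΩtop (pow_ne_zero _ hD0))
    hΩ.measurableSet hc
  refine ⟨S, hS, fun φ g hφ hφΩ hφB hg hg0 hgB hI hP => H φ g hg hg0 hgB hI fun x hx ε hε => ?_⟩
  exact h.abs_le_dyadic_potential hR hΩ.measurableSet
    (hn.le.trans (measure_mono (hball hx))) hφ hφΩ hφB hg0 (hP x) hε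

end Sobolev

/-! ### The Sobolev inequality for vector fields -/

section CarnotCaratheodory

open scoped ENNReal

variable {N d : ℕ} {X : Fin d → EuclideanSpace ℝ (Fin N) → EuclideanSpace ℝ (Fin N)}

theorem eLpNorm_ofReal_eq {α F : Type*} [MeasurableSpace α] [NormedAddCommGroup F] {μ : Measure α}
    {p : ℝ} (hp : 0 < p) (f : α → F) :
    eLpNorm f (ENNReal.ofReal p) μ = (∫⁻ x, ENNReal.ofReal (‖f x‖ ^ p) ∂μ) ^ (1 / p) := by
  rw [eLpNorm_eq_lintegral_rpow_enorm_toReal (by simpa using hp) ENNReal.ofReal_ne_top,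
    ENNReal.toReal_ofReal hp.le]
  congr 1
  refine lintegral_congr fun x => ?_
  rw [← ENNReal.ofReal_rpow_of_nonneg (norm_nonneg _) hp.le, ofReal_norm]

theorem ball_ccPseudoMetric (hX : IsXConnected X) (hE : CCDistEquivEuclidean X)
    (x : EuclideanSpace ℝ (Fin N)) (r : ℝ) :
    @Metric.ball _ (ccPseudoMetric hX hE) x r = ccBall X x r := by
  ext y
  change ccDist X y x < r ↔ ccDist X x y < r
  rw [ccDist_comm]

theorem IsCCDoubling.isDoublingWith (hX : IsXConnected X) (hE : CCDistEquivEuclidean X) {Q : ℝ}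
    (h : IsCCDoubling X Q) :
    @IsDoublingWith _ (ccPseudoMetric hX hE) _ volume (ENNReal.ofReal (2 ^ Q)) := by
  refine @IsDoublingWith.of_isLocallyFiniteMeasure _ (ccPseudoMetric hX hE) _ volume
    (inferInstance : IsLocallyFiniteMeasure (volume : Measure (EuclideanSpace ℝ (Fin N)))) _
    ENNReal.ofReal_ne_top (fun x r hr => ?_) fun x r hr => ?_
  · have := (h x (r / 2) (by positivity)).1.ne'
    rwa [mul_div_cancel₀ _ two_ne_zero, ← ball_ccPseudoMetric hX hE] at this
  · simpa only [ball_ccPseudoMetric] using (h x r hr).2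

theorem continuous_xGrad (hX : ∀ j, Continuous (X j)) {φ : EuclideanSpace ℝ (Fin N) → ℝ}
    (hφ : ContDiff ℝ 1 φ) : Continuous (xGrad X φ) := by
  have h := hφ.continuous_fderiv one_ne_zero
  refine (PiLp.continuous_toLp 2 _).comp (continuous_pi fun j => ?_)
  exact h.clm_apply (hX j)

theorem xGrad_eq_zero {φ : EuclideanSpace ℝ (Fin N) → ℝ} {x : EuclideanSpace ℝ (Fin N)}
    (hx : x ∉ tsupport φ) : xGrad X φ x = 0 := by
  ext j
  simp [xGrad, fderiv_of_notMem_tsupport ℝ hx]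

/-- The Sobolev inequality for test functions. -/
theorem exists_sobolev_smooth [NeZero N] (hX : ∀ j, Continuous (X j))
    (hconn : IsXConnected X) (hequiv : CCDistEquivEuclidean X)
    {Q : ℝ} (hdoubling : IsCCDoubling X Q) (hpoincare : SupportsPoincare X)
    {Ω : Set (EuclideanSpace ℝ (Fin N))} (hΩ : IsOpen Ω) (hΩb : Bornology.IsBounded Ω)
    {p : ℝ} (hp : 1 < p) (hpQ : p < Q) :
    ∃ S : ℝ≥0∞, S ≠ ⊤ ∧ ∀ φ : EuclideanSpace ℝ (Fin N) → ℝ, ContDiff ℝ ∞ φ → HasCompactSupport φ →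
      tsupport φ ⊆ Ω → eLpNorm φ (ENNReal.ofReal (sobolevExponent Q p)) (volume.restrict Ω) ≤
        S * eLpNorm (xGrad X φ) (ENNReal.ofReal p) (volume.restrict Ω) := by
  obtain ⟨C_P, hCP, ν, hν, hP⟩ := hpoincare
  have hp0 : 0 < p := by linarith
  have hr0 : 0 < sobolevExponent Q p := by
    have : 0 < Q - p := by linarith
    have : 0 < Q := by linarith
    rw [sobolevExponent]; positivity
  -- Euclidean boundedness gives a compact closure; compactness is topological, so the closure is
  -- bounded for the control distance as well.
  have hcomp : @Bornology.IsBounded _ (ccPseudoMetric hconn hequiv).toBornology Ω :=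
    @Bornology.IsBounded.subset _ (ccPseudoMetric hconn hequiv).toBornology _ _
      (@IsCompact.isBounded _ (ccPseudoMetric hconn hequiv) _ hΩb.isCompact_closure) subset_closure
  have hμ : volume (Set.univ : Set (EuclideanSpace ℝ (Fin N))) = ⊤ := by
    have : Nontrivial (EuclideanSpace ℝ (Fin N)) := inferInstance
    exact measure_univ_of_isAddLeftInvariant volume
  obtain ⟨S, hS, H⟩ := @IsDoublingWith.exists_sobolev _ (ccPseudoMetric hconn hequiv) _ volume
    (inferInstance : OpensMeasurableSpace (EuclideanSpace ℝ (Fin N)))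
    (inferInstance : SecondCountableTopology (EuclideanSpace ℝ (Fin N)))
    (inferInstance : SFinite (volume : Measure (EuclideanSpace ℝ (Fin N)))) Q p
    (hdoubling.isDoublingWith hconn hequiv) hμ hp hpQ ν C_P hν hCP Ω hΩ hcomp
  refine ⟨S ^ (1 / sobolevExponent Q p), ENNReal.rpow_ne_top_of_nonneg (by positivity) hS,
    fun φ hφ hφc hφΩ => ?_⟩
  have hφ1 : ContDiff ℝ 1 φ := hφ.of_le (by norm_cast)
  have hgc : Continuous fun x => ‖xGrad X φ x‖ := (continuous_xGrad hX hφ1).norm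
  have hgs : HasCompactSupport fun x => ‖xGrad X φ x‖ :=
    hφc.of_isClosed_subset (isClosed_tsupport _) (closure_minimal (fun x hx => by
      by_contra hcon
      exact hx (by simp [xGrad_eq_zero hcon])) (isClosed_tsupport _))
  have hgB : ∃ B, ∀ x, ‖xGrad X φ x‖ ≤ B := by
    obtain ⟨B, hB⟩ := hgc.bounded_above_of_compact_support hgs
    exact ⟨B, fun x => by simpa using hB x⟩
  have hgΩ : ∫⁻ x, ENNReal.ofReal (‖xGrad X φ x‖ ^ p) =
      ∫⁻ x in Ω, ENNReal.ofReal (‖xGrad X φ x‖ ^ p) := by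
    rw [← lintegral_indicator hΩ.measurableSet]
    refine lintegral_congr fun x => ?_
    by_cases hx : x ∈ Ω
    · simp [hx]
    · simp [hx, xGrad_eq_zero fun h => hx (hφΩ h), Real.zero_rpow hp0.ne']
  have hfin : ∫⁻ x, ENNReal.ofReal (‖xGrad X φ x‖ ^ p) ≠ ⊤ := by
    rw [hgΩ]
    obtain ⟨B, hB⟩ := hgB
    refine ne_top_of_le_ne_top (b := ∫⁻ x in Ω, ENNReal.ofReal (B ^ p)) ?_
      (lintegral_mono fun x => ENNReal.ofReal_le_ofReal (by gcongr; exact hB x))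
    rw [setLIntegral_const]
    exact ENNReal.mul_ne_top ENNReal.ofReal_ne_top hΩb.measure_lt_top.ne
  have key := H φ (fun x => ‖xGrad X φ x‖) hφ.continuous
    (fun y hy => image_eq_zero_of_notMem_tsupport fun h => hy (hφΩ h))
    (hφ.continuous.bounded_above_of_compact_support hφc) hgc.measurable (fun x => norm_nonneg _)
    hgB hfin (fun x r hr => by simpa only [ball_ccPseudoMetric] using hP x r hr φ hφ1 hφc)
  rw [eLpNorm_ofReal_eq hr0, eLpNorm_ofReal_eq hp0, ← hgΩ]
  calc _ ≤ _ := ENNReal.rpow_le_rpow key (by positivity)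
    _ = _ := by
      rw [ENNReal.mul_rpow_of_nonneg _ _ (by positivity), ← ENNReal.rpow_mul]
      congr 2
      field_simp

variable {Ω : Set (EuclideanSpace ℝ (Fin N))} {p : ℝ} {u : EuclideanSpace ℝ (Fin N) → ℝ}
  {Du : EuclideanSpace ℝ (Fin N) → EuclideanSpace ℝ (Fin d)}

/-- `L^p` convergence gives convergence in measure, hence almost everywhere along a subsequence;
Fatou's lemma and the chain rule rely on it. -/
theorem IsSobolevZero.exists_approx_ae (hp : 0 < p) (h : IsSobolevZero X Ω p u Du) :
    ∃ φ : ℕ → EuclideanSpace ℝ (Fin N) → ℝ,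
    (∀ n, ContDiff ℝ ∞ (φ n) ∧ HasCompactSupport (φ n) ∧ tsupport (φ n) ⊆ Ω) ∧
    Tendsto (fun n => eLpNorm (fun x => φ n x - u x) (ENNReal.ofReal p) (volume.restrict Ω))
      atTop (𝓝 0) ∧
    Tendsto (fun n => eLpNorm (fun x => xGrad X (φ n) x - Du x) (ENNReal.ofReal p)
      (volume.restrict Ω)) atTop (𝓝 0) ∧
    ∀ᵐ x ∂(volume.restrict Ω), Tendsto (fun n => φ n x) atTop (𝓝 (u x)) := by
  obtain ⟨φ, h1, h2, h3⟩ := h.approx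
  obtain ⟨ns, hns, hae⟩ := (tendstoInMeasure_of_tendsto_eLpNorm (by simpa using hp)
    (fun n => (h1 n).1.continuous.aestronglyMeasurable) h.memLp.1 h2).exists_seq_tendsto_ae
  exact ⟨fun n => φ (ns n), fun n => h1 (ns n), h2.comp hns.tendsto_atTop,
    h3.comp hns.tendsto_atTop, hae⟩

/-- The Sobolev inequality extends from test functions to `W^{1,p}_0`. -/
theorem IsSobolevZero.eLpNorm_le (hX : ∀ j, Continuous (X j)) (hp : 1 ≤ p) {S r : ℝ≥0∞} (hS : S ≠ ⊤)
    (hS' : ∀ φ : EuclideanSpace ℝ (Fin N) → ℝ, ContDiff ℝ ∞ φ → HasCompactSupport φ →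
      tsupport φ ⊆ Ω → eLpNorm φ r (volume.restrict Ω) ≤
        S * eLpNorm (xGrad X φ) (ENNReal.ofReal p) (volume.restrict Ω))
    (h : IsSobolevZero X Ω p u Du) :
    eLpNorm u r (volume.restrict Ω) ≤ S * eLpNorm Du (ENNReal.ofReal p) (volume.restrict Ω) := by
  obtain ⟨φ, h1, -, h3, hae⟩ := h.exists_approx_ae (by linarith)
  have hm : ∀ n, AEStronglyMeasurable (xGrad X (φ n)) (volume.restrict Ω) := fun n =>
    (continuous_xGrad hX ((h1 n).1.of_le (by norm_cast))).aestronglyMeasurable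
  -- Fatou's lemma on the left, since convergence in `L^r` is not known.
  refine (Lp.eLpNorm_lim_le_liminf_eLpNorm
    (fun n => (h1 n).1.continuous.aestronglyMeasurable) u hae).trans ?_
  have hlim : Tendsto (fun n => S * (eLpNorm (fun x => xGrad X (φ n) x - Du x) (ENNReal.ofReal p)
      (volume.restrict Ω) + eLpNorm Du (ENNReal.ofReal p) (volume.restrict Ω))) atTop
      (𝓝 (S * (0 + eLpNorm Du (ENNReal.ofReal p) (volume.restrict Ω)))) :=
    ENNReal.Tendsto.const_mul (h3.add_const _) (Or.inr hS)
  rw [zero_add] at hlim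
  rw [← hlim.liminf_eq]
  refine liminf_le_liminf (Eventually.of_forall fun n => ?_)
  refine (hS' _ (h1 n).1 (h1 n).2.1 (h1 n).2.2).trans ?_
  gcongr
  have := eLpNorm_add_le ((hm n).sub h.memLp_grad.1) h.memLp_grad.1
    (show 1 ≤ ENNReal.ofReal p by simpa using hp)
  rw [sub_add_cancel] at this
  exact this

end CarnotCaratheodory

/-! ### Chain rule in the Sobolev space -/

section ChainRule

open scoped ENNReal

variable {N d : ℕ} {X : Fin d → EuclideanSpace ℝ (Fin N) → EuclideanSpace ℝ (Fin N)}
  {Ω : Set (EuclideanSpace ℝ (Fin N))} {p : ℝ} {u : EuclideanSpace ℝ (Fin N) → ℝ}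
  {Du : EuclideanSpace ℝ (Fin N) → EuclideanSpace ℝ (Fin d)}

/-- Dominated convergence with majorant `‖B • f‖ ^ p`. In the chain rule it treats `(G'(φₙ) - G'(u))
Du`, whose coefficient converges only almost everywhere. -/
theorem tendsto_eLpNorm_smul_of_bounded {α F : Type*} [MeasurableSpace α] [NormedAddCommGroup F]
    [NormedSpace ℝ F] {μ : Measure α} {p : ℝ} (hp : 0 < p) {f : α → F}
    (hf : MemLp f (ENNReal.ofReal p) μ) {c : ℕ → α → ℝ} (hc : ∀ n, AEStronglyMeasurable (c n) μ)
    {B : ℝ} (hB : ∀ n x, |c n x| ≤ B) (hlim : ∀ᵐ x ∂μ, Tendsto (fun n => c n x) atTop (𝓝 0)) :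
    Tendsto (fun n => eLpNorm (fun x => c n x • f x) (ENNReal.ofReal p) μ) atTop (𝓝 0) := by
  simp only [eLpNorm_ofReal_eq hp]
  have hzero : (0 : ℝ≥0∞) = (∫⁻ _, 0 ∂μ) ^ (1 / p) := by
    rw [lintegral_zero, ENNReal.zero_rpow_of_pos (by positivity)]
  rw [hzero]
  refine (ENNReal.continuous_rpow_const.tendsto _).comp ?_
  have hBf := hf.const_smul B
  refine tendsto_lintegral_of_dominated_convergence' (fun x => ENNReal.ofReal (‖B • f x‖ ^ p))
    (fun n => ?_) (fun n => Eventually.of_forall fun x => ?_) ?_ ?_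
  · exact (((hc n).smul hf.1).norm.aemeasurable.pow_const p).ennreal_ofReal
  · refine ENNReal.ofReal_le_ofReal (Real.rpow_le_rpow (norm_nonneg _) ?_ hp.le)
    rw [norm_smul, norm_smul]
    gcongr
    exact (hB n x).trans (le_abs_self B)
  · have h := hBf.2.ne
    rw [eLpNorm_ofReal_eq hp] at h
    intro htop
    exact h (by simp only [Pi.smul_apply]; rw [htop, ENNReal.top_rpow_of_pos (by positivity)])
  · filter_upwards [hlim] with x hx
    have h1 : Tendsto (fun n => ENNReal.ofReal (‖c n x • f x‖ ^ p)) atTop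
        (𝓝 (ENNReal.ofReal (‖(0 : ℝ) • f x‖ ^ p))) :=
      ENNReal.tendsto_ofReal (((hx.smul_const (f x)).norm).rpow_const (Or.inr hp.le))
    simpa [Real.zero_rpow hp.ne'] using h1

theorem xGrad_comp {G : ℝ → ℝ} {φ : EuclideanSpace ℝ (Fin N) → ℝ} {x : EuclideanSpace ℝ (Fin N)}
    (hG : DifferentiableAt ℝ G (φ x)) (hφ : DifferentiableAt ℝ φ x) :
    xGrad X (fun y => G (φ y)) x = deriv G (φ x) • xGrad X φ x := by
  ext j
  have h := (hG.hasDerivAt.comp_hasFDerivAt x hφ.hasFDerivAt).fderiv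
  simp only [Function.comp_def] at h
  simp [xGrad, h]

/-- The chain rule in `W^{1,p}_0`, for smooth functions with bounded derivative. -/
theorem IsSobolevZero.comp (hX : ∀ j, Continuous (X j)) (hp : 1 ≤ p)
    (h : IsSobolevZero X Ω p u Du) {G : ℝ → ℝ} (hG : ContDiff ℝ ∞ G) (hG0 : G 0 = 0) {B : ℝ}
    (hB : ∀ t, |deriv G t| ≤ B) :
    IsSobolevZero X Ω p (fun x => G (u x)) (fun x => deriv G (u x) • Du x) := by
  have hp0 : 0 < p := by linarith
  have hGd : Differentiable ℝ G := hG.differentiable (by simp)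
  have hG'c : Continuous (deriv G) := hG.continuous_deriv (by norm_cast)
  have hlip : ∀ s t, ‖G s - G t‖ ≤ B * ‖s - t‖ := fun s t =>
    convex_univ.norm_image_sub_le_of_norm_deriv_le (fun x _ => hGd x) (fun x _ => hB x)
      (Set.mem_univ t) (Set.mem_univ s)
  obtain ⟨φ, h1, h2, h3, hae⟩ := h.exists_approx_ae hp0
  have hgm : ∀ n, AEStronglyMeasurable (xGrad X (φ n)) (volume.restrict Ω) := fun n =>
    (continuous_xGrad hX ((h1 n).1.of_le (by norm_cast))).aestronglyMeasurable
  have hφm : ∀ n, AEStronglyMeasurable (φ n) (volume.restrict Ω) := fun n =>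
    (h1 n).1.continuous.aestronglyMeasurable
  have hG'm : ∀ {v : EuclideanSpace ℝ (Fin N) → ℝ}, AEStronglyMeasurable v (volume.restrict Ω) →
      AEStronglyMeasurable (fun x => deriv G (v x)) (volume.restrict Ω) := fun hv =>
    hG'c.comp_aestronglyMeasurable hv
  refine ⟨?_, ?_, fun n x => G (φ n x), fun n => ⟨hG.comp (h1 n).1, ?_, ?_⟩, ?_, ?_⟩
  · exact h.memLp.of_le_mul (c := B) (hGd.continuous.comp_aestronglyMeasurable h.memLp.1)
      (Eventually.of_forall fun x => by simpa [hG0] using hlip (u x) 0)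
  · exact h.memLp_grad.of_le_mul (c := B) ((hG'm h.memLp.1).smul h.memLp_grad.1)
      (Eventually.of_forall fun x => by rw [norm_smul]; gcongr; exact hB _)
  · exact (h1 n).2.1.comp_left hG0
  · exact (tsupport_comp_subset hG0 (φ n)).trans (h1 n).2.2
  · refine tendsto_of_tendsto_of_tendsto_of_le_of_le tendsto_const_nhds
      (h := fun n => ENNReal.ofReal B *
        eLpNorm (fun x => φ n x - u x) (ENNReal.ofReal p) (volume.restrict Ω)) ?_
      (fun n => zero_le) fun n => ?_
    · simpa using ENNReal.Tendsto.const_mul h2 (Or.inr (ENNReal.ofReal_ne_top (r := B)))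
    · exact eLpNorm_le_mul_eLpNorm_of_ae_le_mul (Eventually.of_forall fun x => hlip _ _) _
  · have hsmall := tendsto_eLpNorm_smul_of_bounded hp0 h.memLp_grad
      (c := fun n x => deriv G (φ n x) - deriv G (u x)) (B := B + B)
      (fun n => (hG'm (hφm n)).sub (hG'm h.memLp.1))
      (fun n x => (abs_sub _ _).trans (add_le_add (hB _) (hB _))) (by
        filter_upwards [hae] with x hx
        simpa using ((hG'c.tendsto (u x)).comp hx).sub_const (deriv G (u x)))
    have hsum := (ENNReal.Tendsto.const_mul h3
      (Or.inr (ENNReal.ofReal_ne_top (r := B)))).add hsmall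
    rw [mul_zero, add_zero] at hsum
    refine tendsto_of_tendsto_of_tendsto_of_le_of_le tendsto_const_nhds hsum
      (fun n => zero_le) fun n => ?_
    -- The first term is small by convergence of the gradients and boundedness of `G'`, the second
    -- by `hsmall`.
    have hdec : (fun x => xGrad X (fun y => G (φ n y)) x - deriv G (u x) • Du x) =
        (fun x => deriv G (φ n x) • (xGrad X (φ n) x - Du x)) +
          fun x => (deriv G (φ n x) - deriv G (u x)) • Du x := by
      funext x
      rw [xGrad_comp (hGd _) ((h1 n).1.differentiable (by simp) x), Pi.add_apply, smul_sub, sub_smul]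
      abel
    dsimp only
    rw [hdec]
    refine (eLpNorm_add_le ((hG'm (hφm n)).smul ((hgm n).sub h.memLp_grad.1))
      (((hG'm (hφm n)).sub (hG'm h.memLp.1)).smul h.memLp_grad.1) (by simpa using hp)).trans ?_
    refine add_le_add (eLpNorm_le_mul_eLpNorm_of_ae_le_mul (Eventually.of_forall fun x => ?_) _)
      le_rfl
    change ‖deriv G (φ n x) • (xGrad X (φ n) x - Du x)‖ ≤ _
    rw [norm_smul]
    gcongr
    exact hB _

/-- A primitive of a smooth function, vanishing at the origin, is smooth. -/
theorem contDiff_primitive {w : ℝ → ℝ} (hw : ContDiff ℝ ∞ w) :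
    ContDiff ℝ ∞ (fun t => ∫ s in (0 : ℝ)..t, w s) ∧
      deriv (fun t => ∫ s in (0 : ℝ)..t, w s) = w := by
  have h : ∀ t, HasDerivAt (fun t => ∫ s in (0 : ℝ)..t, w s) (w t) t := fun t =>
    hw.continuous.integral_hasStrictDerivAt 0 t |>.hasDerivAt
  have hd : deriv (fun t => ∫ s in (0 : ℝ)..t, w s) = w := funext fun t => (h t).deriv
  refine ⟨contDiff_infty_iff_deriv.2 ⟨fun t => (h t).differentiableAt, ?_⟩, hd⟩
  rwa [hd]

end ChainRule

/-! ### Measurability of the composed nonlinearity -/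

section Caratheodory

variable {α Z F : Type*} [MeasurableSpace α] {μ : Measure α} [TopologicalSpace Z]
  [NormedAddCommGroup F]

/-- Substituting a measurable function into a Carathéodory function. -/
theorem aestronglyMeasurable_caratheodory {a : α → Z → F}
    (hm : ∀ c, AEStronglyMeasurable (fun x => a x c) μ) (hc : ∀ᵐ x ∂μ, Continuous (a x))
    {z : α → Z} (hz : AEStronglyMeasurable z μ) : AEStronglyMeasurable (fun x => a x (z x)) μ := by
  have hsimple : ∀ s : SimpleFunc α Z, AEStronglyMeasurable (fun x => a x (s x)) μ := by
    intro s
    have : (fun x => a x (s x)) =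
        fun x => ∑ c ∈ s.range, (s ⁻¹' {c}).indicator (fun x => a x c) x := by
      funext x
      rw [Finset.sum_eq_single (s x)]
      · simp
      · intro c _ hcx
        exact Set.indicator_of_notMem (fun h => hcx h.symm) _
      · exact fun h => absurd (s.mem_range_self x) h
    rw [this]
    exact Finset.aestronglyMeasurable_fun_sum _ fun c _ =>
      (hm c).indicator (s.measurableSet_fiber c)
  have hzm := hz.stronglyMeasurable_mk
  have hlim : AEStronglyMeasurable (fun x => a x (hz.mk z x)) μ := by
    refine aestronglyMeasurable_of_tendsto_ae atTop (fun n => hsimple (hzm.approx n)) ?_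
    filter_upwards [hc] with x hx
    exact (hx.tendsto _).comp (hzm.tendsto_approx x)
  refine hlim.congr ?_
  filter_upwards [hz.ae_eq_mk] with x hx
  rw [hx]

end Caratheodory

/-! ### The energy estimate -/

section Energy

open scoped ENNReal

theorem integrable_inner_of_memLp {α F : Type*} [MeasurableSpace α] {μ : Measure α}
    [NormedAddCommGroup F] [InnerProductSpace ℝ F] {p q : ℝ} (hpq : p.HolderConjugate q)
    {f g : α → F} (hf : MemLp f (ENNReal.ofReal q) μ) (hg : MemLp g (ENNReal.ofReal p) μ) :
    Integrable (fun x => inner ℝ (f x) (g x)) μ := by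
  have := hpq.symm.ennrealOfReal
  refine (hf.norm.integrable_mul hg.norm).mono' (hf.1.inner hg.1)
    (Eventually.of_forall fun x => norm_inner_le_norm _ _)

theorem integrable_norm_rpow_of_memLp {α F : Type*} [MeasurableSpace α] {μ : Measure α}
    [NormedAddCommGroup F] {p : ℝ} (hp : 0 < p) {f : α → F} (hf : MemLp f (ENNReal.ofReal p) μ) :
    Integrable (fun x => ‖f x‖ ^ p) μ := by
  have := hf.integrable_norm_rpow (by simpa using hp) ENNReal.ofReal_ne_top
  rwa [ENNReal.toReal_ofReal hp.le] at this

variable {N d : ℕ} {X : Fin d → EuclideanSpace ℝ (Fin N) → EuclideanSpace ℝ (Fin N)}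
  {Ω : Set (EuclideanSpace ℝ (Fin N))} {p α β : ℝ} {h : EuclideanSpace ℝ (Fin N) → ℝ}
  {a : EuclideanSpace ℝ (Fin N) → ℝ → EuclideanSpace ℝ (Fin d) → EuclideanSpace ℝ (Fin d)}
  {F Du : EuclideanSpace ℝ (Fin N) → EuclideanSpace ℝ (Fin d)} {u : EuclideanSpace ℝ (Fin N) → ℝ}

/-- Each term of the growth bound lies in `L^{p'}` because `(p - 1) p' = p`. The pairing with a
gradient in `L^p` is then a genuine integral, not the default value `0`. -/
theorem IsLerayLions.memLp_comp (ha : IsLerayLions Ω p α β h a) (hp : 1 < p) (hβ : 0 ≤ β)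
    (hh : MemLp h (ENNReal.ofReal (p / (p - 1))) (volume.restrict Ω))
    (hu : MemLp u (ENNReal.ofReal p) (volume.restrict Ω))
    (hDu : MemLp Du (ENNReal.ofReal p) (volume.restrict Ω)) :
    MemLp (fun x => a x (u x) (Du x)) (ENNReal.ofReal (p / (p - 1))) (volume.restrict Ω) := by
  have hm : AEStronglyMeasurable (fun x => a x (u x) (Du x)) (volume.restrict Ω) :=
    aestronglyMeasurable_caratheodory (Z := ℝ × EuclideanSpace ℝ (Fin d))
      (a := fun x z => a x z.1 z.2) (fun c => (ha.measurable c.1 c.2).aestronglyMeasurable)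
      ha.continuous (hu.1.prodMk hDu.1)
  have hpow : ∀ {E : Type} [NormedAddCommGroup E] {f : EuclideanSpace ℝ (Fin N) → E},
      MemLp f (ENNReal.ofReal p) (volume.restrict Ω) →
      MemLp (fun x => ‖f x‖ ^ (p - 1)) (ENNReal.ofReal (p / (p - 1))) (volume.restrict Ω) := by
    intro E _ f hf
    have := hf.norm_rpow_div (ENNReal.ofReal (p - 1))
    rwa [ENNReal.toReal_ofReal (by linarith), ← ENNReal.ofReal_div_of_pos (by linarith)] at this
  refine ((hh.add (hpow hu)).add (hpow hDu)).of_le_mul (c := β) hm ?_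
  filter_upwards [ha.growth] with x hx
  refine (hx (u x) (Du x)).trans ?_
  gcongr
  exact Real.le_norm_self _

/-- The energy estimate: testing the equation with a primitive of `w ^ p` evaluated at `u`. -/
theorem IsLerayLions.lintegral_energy_le (ha : IsLerayLions Ω p α β h a)
    (hX : ∀ j, Continuous (X j)) (hp : 1 < p) (hα : 0 < α) (hβ : 0 ≤ β)
    (hh : MemLp h (ENNReal.ofReal (p / (p - 1))) (volume.restrict Ω))
    (hF : MemLp F (ENNReal.ofReal (p / (p - 1))) (volume.restrict Ω))
    (hu : IsSobolevZero X Ω p u Du)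
    (heq : ∀ (v : EuclideanSpace ℝ (Fin N) → ℝ)
      (Dv : EuclideanSpace ℝ (Fin N) → EuclideanSpace ℝ (Fin d)), IsSobolevZero X Ω p v Dv →
        ∫ x in Ω, inner ℝ (a x (u x) (Du x)) (Dv x) = ∫ x in Ω, inner ℝ (F x) (Dv x))
    {w : ℝ → ℝ} (hw : ContDiff ℝ ∞ w) (hw0 : ∀ t, 0 < w t) {B : ℝ} (hB : ∀ t, w t ≤ B) :
    ∫⁻ x in Ω, ENNReal.ofReal (‖w (u x) • Du x‖ ^ p) ≤
      ENNReal.ofReal ((α ^ (-(1 / p))) ^ (p / (p - 1)) / α) *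
        ∫⁻ x in Ω, ENNReal.ofReal (‖F x‖ ^ (p / (p - 1)) * w (u x) ^ p) := by
  have hp0 : 0 < p := by linarith
  have hconj : p.HolderConjugate (p / (p - 1)) := Real.HolderConjugate.conjExponent hp
  set p' := p / (p - 1) with hp'
  have hp'0 : 0 < p' := hconj.symm.pos
  set κ := (α ^ (-(1 / p))) ^ p' with hκ
  have hκ0 : 0 < κ := by positivity
  have hwp : ContDiff ℝ ∞ (fun t => w t ^ p) := hw.rpow_const_of_ne fun t => (hw0 t).ne'
  have hB0 : 0 < B := (hw0 0).trans_le (hB 0)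
  obtain ⟨hG, hG'⟩ := contDiff_primitive hwp
  have hv := hu.comp hX hp.le hG (by simp) (B := B ^ p) (fun t => by
    rw [hG', abs_of_nonneg (by have := hw0 t; positivity)]
    exact Real.rpow_le_rpow (hw0 t).le (hB t) hp0.le)
  rw [hG'] at hv
  -- The test function is `∫₀ᵘ w^p`, treated above; this second primitive only supplies
  -- integrability of `‖w(u) Du‖ ^ p`.
  have hwv := hu.comp hX hp.le (contDiff_primitive hw).1 (by simp) (B := B) (fun t => by
    rw [(contDiff_primitive hw).2, abs_of_pos (hw0 t)]
    exact hB t)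
  rw [(contDiff_primitive hw).2] at hwv
  have hPint : IntegrableOn (fun x => ‖w (u x) • Du x‖ ^ p) Ω :=
    integrable_norm_rpow_of_memLp hp0 hwv.memLp_grad
  have hRint : IntegrableOn (fun x => ‖F x‖ ^ p' * w (u x) ^ p) Ω := by
    refine (integrable_norm_rpow_of_memLp hp'0 hF).mul_bdd (c := B ^ p)
      (hwp.continuous.comp_aestronglyMeasurable hu.memLp.1) (Eventually.of_forall fun x => ?_)
    have := hw0 (u x)
    rw [Real.norm_of_nonneg (by positivity)]
    exact Real.rpow_le_rpow (hw0 _).le (hB _) hp0.le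
  have hf1 := integrable_inner_of_memLp hconj (ha.memLp_comp hp hβ hh hu.memLp hu.memLp_grad)
    hv.memLp_grad
  have hf2 := integrable_inner_of_memLp hconj hF hv.memLp_grad
  have hnorm : ∀ x, ‖w (u x) • Du x‖ ^ p = w (u x) ^ p * ‖Du x‖ ^ p := fun x => by
    rw [norm_smul, Real.norm_of_nonneg (hw0 _).le, Real.mul_rpow (hw0 _).le (norm_nonneg _)]
  have hlow : α * ∫ x in Ω, ‖w (u x) • Du x‖ ^ p ≤
      ∫ x in Ω, inner ℝ (a x (u x) (Du x)) (w (u x) ^ p • Du x) := by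
    rw [← integral_const_mul]
    refine integral_mono_ae (hPint.const_mul α) hf1 ?_
    filter_upwards [ha.elliptic] with x hx
    have h1 := hx (u x) (Du x)
    have h2 : 0 < w (u x) ^ p := Real.rpow_pos_of_pos (hw0 _) p
    rw [hnorm, inner_smul_right]
    nlinarith
  have hup : ∫ x in Ω, inner ℝ (F x) (w (u x) ^ p • Du x) ≤
      α / p * (∫ x in Ω, ‖w (u x) • Du x‖ ^ p) +
        κ / p' * ∫ x in Ω, ‖F x‖ ^ p' * w (u x) ^ p := by
    rw [← integral_const_mul, ← integral_const_mul,
      ← integral_add (hPint.const_mul _) (hRint.const_mul _)]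
    refine integral_mono hf2 ((hPint.const_mul _).add (hRint.const_mul _)) fun x => ?_
    have hwx : 0 < w (u x) ^ p := Real.rpow_pos_of_pos (hw0 _) p
    -- The weights `α^{±1/p}` give `‖Du‖ ^ p` the coefficient `α/p`; subtracted from the `α` of
    -- ellipticity, this leaves `α/p'`.
    have hy := Real.young_inequality_of_nonneg (a := α ^ (1 / p) * ‖Du x‖)
      (b := α ^ (-(1 / p)) * ‖F x‖) (by positivity) (by positivity) hconj
    have e1 : α ^ (1 / p) * ‖Du x‖ * (α ^ (-(1 / p)) * ‖F x‖) = ‖F x‖ * ‖Du x‖ := by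
      have : α ^ (1 / p) * α ^ (-(1 / p)) = 1 := by rw [← Real.rpow_add hα]; simp
      linear_combination (‖F x‖ * ‖Du x‖) * this
    have e2 : (α ^ (1 / p) * ‖Du x‖) ^ p = α * ‖Du x‖ ^ p := by
      rw [Real.mul_rpow (by positivity) (norm_nonneg _), ← Real.rpow_mul hα.le,
        one_div_mul_cancel hp0.ne', Real.rpow_one]
    have e3 : (α ^ (-(1 / p)) * ‖F x‖) ^ p' = κ * ‖F x‖ ^ p' := by
      rw [Real.mul_rpow (by positivity) (norm_nonneg _)]
    rw [e1, e2, e3] at hy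
    dsimp only
    rw [inner_smul_right, hnorm]
    calc w (u x) ^ p * inner ℝ (F x) (Du x)
        ≤ w (u x) ^ p * (α * ‖Du x‖ ^ p / p + κ * ‖F x‖ ^ p' / p') := by
          gcongr
          exact (real_inner_le_norm _ _).trans hy
      _ = _ := by ring
  have hmain := heq _ _ hv
  dsimp only at hmain
  have hfin : ∫ x in Ω, ‖w (u x) • Du x‖ ^ p ≤
      κ / α * ∫ x in Ω, ‖F x‖ ^ p' * w (u x) ^ p := by
    have h1 := hlow.trans (hmain.le.trans hup)
    have e : 1 / p' = 1 - 1 / p := by rw [hp']; field_simp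
    have h2 : α * (1 / p') * ∫ x in Ω, ‖w (u x) • Du x‖ ^ p ≤
        κ * (1 / p') * ∫ x in Ω, ‖F x‖ ^ p' * w (u x) ^ p := by
      have : κ / p' = κ * (1 / p') := by ring
      rw [this] at h1
      rw [e] at h1 ⊢
      have : α / p = α * (1 / p) := by ring
      rw [this] at h1
      linarith
    have h3 : 0 < 1 / p' := by positivity
    rw [div_mul_eq_mul_div, le_div_iff₀ hα]
    refine le_of_mul_le_mul_right ?_ h3
    linarith
  rw [← ofReal_integral_eq_lintegral_ofReal hPint (Eventually.of_forall fun x => by positivity),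
    ← ofReal_integral_eq_lintegral_ofReal hRint (Eventually.of_forall fun x => by
      have := hw0 (u x); positivity), ← ENNReal.ofReal_mul (by positivity)]
  exact ENNReal.ofReal_le_ofReal hfin

/-- The energy estimate combined with the Sobolev inequality. -/
theorem IsLerayLions.lintegral_primitive_le (ha : IsLerayLions Ω p α β h a)
    (hX : ∀ j, Continuous (X j)) (hp : 1 < p) (hα : 0 < α) (hβ : 0 ≤ β)
    (hh : MemLp h (ENNReal.ofReal (p / (p - 1))) (volume.restrict Ω))
    (hF : MemLp F (ENNReal.ofReal (p / (p - 1))) (volume.restrict Ω))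
    (hu : IsSobolevZero X Ω p u Du)
    (heq : ∀ (v : EuclideanSpace ℝ (Fin N) → ℝ)
      (Dv : EuclideanSpace ℝ (Fin N) → EuclideanSpace ℝ (Fin d)), IsSobolevZero X Ω p v Dv →
        ∫ x in Ω, inner ℝ (a x (u x) (Du x)) (Dv x) = ∫ x in Ω, inner ℝ (F x) (Dv x))
    {r : ℝ} (hr : 0 < r) {S : ℝ≥0∞} (hS : S ≠ ⊤)
    (hS' : ∀ φ : EuclideanSpace ℝ (Fin N) → ℝ, ContDiff ℝ ∞ φ → HasCompactSupport φ →
      tsupport φ ⊆ Ω → eLpNorm φ (ENNReal.ofReal r) (volume.restrict Ω) ≤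
        S * eLpNorm (xGrad X φ) (ENNReal.ofReal p) (volume.restrict Ω))
    {w : ℝ → ℝ} (hw : ContDiff ℝ ∞ w) (hw0 : ∀ t, 0 < w t) {B : ℝ} (hB : ∀ t, w t ≤ B) :
    (∫⁻ x in Ω, ENNReal.ofReal (|∫ s in (0 : ℝ)..u x, w s| ^ r)) ≠ ⊤ ∧
    (∫⁻ x in Ω, ENNReal.ofReal (|∫ s in (0 : ℝ)..u x, w s| ^ r)) ^ (p / r) ≤
      S ^ p * (ENNReal.ofReal ((α ^ (-(1 / p))) ^ (p / (p - 1)) / α) *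
        ∫⁻ x in Ω, ENNReal.ofReal (‖F x‖ ^ (p / (p - 1)) * w (u x) ^ p)) := by
  have hp0 : 0 < p := by linarith
  have hwv := hu.comp hX hp.le (contDiff_primitive hw).1 (by simp) (B := B) (fun t => by
    rw [(contDiff_primitive hw).2, abs_of_pos (hw0 t)]
    exact hB t)
  rw [(contDiff_primitive hw).2] at hwv
  have h1 := hwv.eLpNorm_le hX hp.le hS hS'
  have h2 := ha.lintegral_energy_le hX hp hα hβ hh hF hu heq hw hw0 hB
  have h3 : S * eLpNorm (fun x => w (u x) • Du x) (ENNReal.ofReal p) (volume.restrict Ω) ≠ ⊤ :=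
    ENNReal.mul_ne_top hS hwv.memLp_grad.2.ne
  rw [eLpNorm_ofReal_eq hr] at h1
  rw [eLpNorm_ofReal_eq hp0] at h1 h3
  simp only [Real.norm_eq_abs] at h1
  -- Finiteness, indispensable for the later absorption, follows from Sobolev and the boundedness of
  -- `w`.
  constructor
  · intro htop
    have h4 := ne_top_of_le_ne_top h3 h1
    rw [htop, ENNReal.top_rpow_of_pos (by positivity)] at h4
    exact h4 rfl
  · have h4 := ENNReal.rpow_le_rpow h1 hp0.le
    rw [← ENNReal.rpow_mul, ENNReal.mul_rpow_of_nonneg _ _ hp0.le, ← ENNReal.rpow_mul,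
      one_div_mul_cancel hp0.ne', ENNReal.rpow_one, div_mul_eq_mul_div, one_mul] at h4
    exact h4.trans (by gcongr)

end Energy

/-! ### Regularised power weights -/

section Weights

/-- A bounded regularisation of `t ↦ t ^ 2`, bounded away from zero. -/
noncomputable def regSq (ε t : ℝ) : ℝ := (ε + t ^ 2) / (1 + ε * t ^ 2)

variable {ε s r q : ℝ}

theorem regSq_pos (hε : 0 < ε) (t : ℝ) : 0 < regSq ε t := by
  rw [regSq]; positivity

theorem regSq_le_inv (hε : 0 < ε) (t : ℝ) : regSq ε t ≤ ε⁻¹ + ε := by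
  rw [regSq, div_le_iff₀ (by positivity)]
  have h : ε⁻¹ * ε = 1 := inv_mul_cancel₀ hε.ne'
  have : (ε⁻¹ + ε) * (1 + ε * t ^ 2) = ε⁻¹ + ε + t ^ 2 + ε ^ 2 * t ^ 2 := by
    linear_combination t ^ 2 * h
  rw [this]
  have : 0 < ε⁻¹ := by positivity
  nlinarith [sq_nonneg (ε * t)]

theorem regSq_le (hε : 0 < ε) (t : ℝ) : regSq ε t ≤ ε + t ^ 2 :=
  div_le_self (by positivity) (by nlinarith [sq_nonneg t])

theorem regSq_neg (t : ℝ) : regSq ε (-t) = regSq ε t := by simp [regSq]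

theorem contDiff_regSq_rpow (hε : 0 < ε) (s : ℝ) : ContDiff ℝ ∞ fun t => regSq ε t ^ s := by
  refine ContDiff.rpow_const_of_ne ?_ fun t => (regSq_pos hε t).ne'
  unfold regSq
  exact (by fun_prop : ContDiff ℝ ∞ fun t : ℝ => ε + t ^ 2).div (by fun_prop)
    fun t => by positivity

/-- Replaces monotonicity, which fails for `ε > 1`: between `t/2` and `t` the numerator loses at
most a factor `4`, and the denominator does not exceed its value at `t`. -/
theorem regSq_div_four_le (hε : 0 < ε) {t τ : ℝ} (ht : 0 ≤ t) (h1 : t / 2 ≤ τ) (h2 : τ ≤ t) :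
    regSq ε t / 4 ≤ regSq ε τ := by
  rw [regSq, regSq, div_right_comm]
  have h3 : t ^ 2 / 4 ≤ τ ^ 2 := by nlinarith
  have h4 : τ ^ 2 ≤ t ^ 2 := by nlinarith
  gcongr ?_ / (1 + ε * ?_)
  · linarith

/-- The primitive of a power of `regSq` is comparable with `t` times that power. -/
theorem abs_mul_regSq_rpow_le (hε : 0 < ε) (hs : 0 ≤ s) (t : ℝ) :
    |t| * regSq ε t ^ s ≤ 2 * 4 ^ s * |∫ τ in (0 : ℝ)..t, regSq ε τ ^ s| := by
  have hcont : Continuous fun τ => regSq ε τ ^ s := (contDiff_regSq_rpow hε s).continuous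
  have hpos : ∀ t, 0 ≤ t →
      t * regSq ε t ^ s ≤ 2 * 4 ^ s * |∫ τ in (0 : ℝ)..t, regSq ε τ ^ s| := by
    intro t ht
    have h1 : ∫ τ in (0 : ℝ)..t, regSq ε τ ^ s = (∫ τ in (0 : ℝ)..(t / 2), regSq ε τ ^ s) +
        ∫ τ in (t / 2)..t, regSq ε τ ^ s :=
      (intervalIntegral.integral_add_adjacent_intervals (hcont.intervalIntegrable _ _)
        (hcont.intervalIntegrable _ _)).symm
    have h2 : 0 ≤ ∫ τ in (0 : ℝ)..(t / 2), regSq ε τ ^ s :=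
      intervalIntegral.integral_nonneg (by linarith) fun τ _ => by
        have := regSq_pos hε τ; positivity
    have h3 : ∫ _ in (t / 2)..t, (regSq ε t / 4) ^ s ≤ ∫ τ in (t / 2)..t, regSq ε τ ^ s := by
      refine intervalIntegral.integral_mono_on (by linarith) (by simp)
        (hcont.intervalIntegrable _ _) fun τ hτ => ?_
      have := regSq_pos hε t
      exact Real.rpow_le_rpow (by positivity) (regSq_div_four_le hε ht hτ.1 hτ.2) hs
    rw [intervalIntegral.integral_const, smul_eq_mul,
      Real.div_rpow (regSq_pos hε t).le (by norm_num)] at h3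
    have h4 : (0 : ℝ) < 4 ^ s := by positivity
    calc t * regSq ε t ^ s = 2 * 4 ^ s * ((t - t / 2) * (regSq ε t ^ s / 4 ^ s)) := by
          field_simp; ring
      _ ≤ 2 * 4 ^ s * ∫ τ in (0 : ℝ)..t, regSq ε τ ^ s := by gcongr; linarith
      _ ≤ _ := by gcongr; exact le_abs_self _
  rcases le_total 0 t with ht | ht
  · rw [abs_of_nonneg ht]
    exact hpos t ht
  · have h := hpos (-t) (by linarith)
    have e : ∫ τ in (0 : ℝ)..(-t), regSq ε τ ^ s = -∫ τ in (0 : ℝ)..t, regSq ε τ ^ s := by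
      have := intervalIntegral.integral_comp_neg (fun τ => regSq ε τ ^ s) (a := 0) (b := -t)
      simp only [regSq_neg, neg_neg, neg_zero] at this
      rw [this, intervalIntegral.integral_symm]
    rwa [regSq_neg, e, abs_neg, ← abs_of_nonpos ht] at h

/-- `regSq ε t ^ (q/2)` stands for `|t|^q` in the Hölder step. If `ε ≤ t²`, then `regSq ε t ≤ 2t²`,
and splitting the power as `q/2 = r/2 + sr` leads back to the primitive. Otherwise `regSq ε t ≤ 2ε`,
which is the error term. -/
theorem regSq_rpow_half_le (hε : 0 < ε) (hs : 0 ≤ s) (hr : 0 < r) (hq : q = r * (1 + 2 * s)) (t : ℝ) :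
    regSq ε t ^ (q / 2) ≤ (2 ^ (r / 2) * (2 * 4 ^ s) ^ r + 2 ^ (q / 2)) *
      (|∫ τ in (0 : ℝ)..t, regSq ε τ ^ s| ^ r + ε ^ (q / 2)) := by
  have hb := regSq_pos hε t
  have hq0 : 0 < q := by rw [hq]; positivity
  set I := |∫ τ in (0 : ℝ)..t, regSq ε τ ^ s| with hI
  have hI0 : 0 ≤ I := abs_nonneg _
  rcases le_total ε (t ^ 2) with h | h
  · have h1 : regSq ε t ^ (r / 2) ≤ 2 ^ (r / 2) * |t| ^ r := by
      have e : |t| ^ r = (t ^ 2) ^ (r / 2) := by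
        rw [← sq_abs, ← Real.rpow_natCast, ← Real.rpow_mul (abs_nonneg t)]
        congr 1
        push_cast
        ring
      rw [e, ← Real.mul_rpow (by norm_num) (sq_nonneg t)]
      exact Real.rpow_le_rpow hb.le ((regSq_le hε t).trans (by linarith)) (by positivity)
    calc regSq ε t ^ (q / 2) = regSq ε t ^ (r / 2) * (regSq ε t ^ s) ^ r := by
          rw [← Real.rpow_mul hb.le, ← Real.rpow_add hb, hq]
          congr 1
          ring
      _ ≤ 2 ^ (r / 2) * |t| ^ r * (regSq ε t ^ s) ^ r := by gcongr
      _ = 2 ^ (r / 2) * (|t| * regSq ε t ^ s) ^ r := by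
          rw [Real.mul_rpow (abs_nonneg t) (by positivity), mul_assoc]
      _ ≤ 2 ^ (r / 2) * (2 * 4 ^ s * I) ^ r := by
          exact mul_le_mul_of_nonneg_left (Real.rpow_le_rpow (by positivity)
            (abs_mul_regSq_rpow_le hε hs t) hr.le) (by positivity)
      _ = 2 ^ (r / 2) * (2 * 4 ^ s) ^ r * I ^ r := by
          rw [Real.mul_rpow (by positivity) hI0, mul_assoc]
      _ ≤ _ := by
          gcongr
          · exact le_add_of_nonneg_right (by positivity)
          · exact le_add_of_nonneg_right (by positivity)
  · calc regSq ε t ^ (q / 2) ≤ (2 * ε) ^ (q / 2) :=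
          Real.rpow_le_rpow hb.le ((regSq_le hε t).trans (by linarith)) (by positivity)
      _ = 2 ^ (q / 2) * ε ^ (q / 2) := Real.mul_rpow (by norm_num) hε.le
      _ ≤ _ := by
          gcongr
          · exact le_add_of_nonneg_left (by positivity)
          · exact le_add_of_nonneg_left (by positivity)

theorem tendsto_abs_mul_regSq_rpow (hs : 0 ≤ s) (hr : 0 < r) (hq : q = r * (1 + 2 * s)) (t : ℝ) :
    Tendsto (fun ε => (|t| * regSq ε t ^ s) ^ r) (𝓝 0) (𝓝 (|t| ^ q)) := by
  have h1 : Tendsto (fun ε => regSq ε t) (𝓝 0) (𝓝 (t ^ 2)) := by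
    have : ContinuousAt (fun ε => regSq ε t) 0 := by
      unfold regSq
      exact ContinuousAt.div (by fun_prop) (by fun_prop) (by simp)
    simpa [ContinuousAt, regSq] using this
  have h2 := ((h1.rpow_const (Or.inr hs)).const_mul |t|).rpow_const (p := r) (Or.inr hr.le)
  have e : (|t| * (t ^ 2) ^ s) ^ r = |t| ^ q := by
    rw [← sq_abs, ← Real.rpow_natCast, ← Real.rpow_mul (abs_nonneg t)]
    nth_rewrite 1 [← Real.rpow_one |t|]
    rw [← Real.rpow_add_of_nonneg (abs_nonneg t) zero_le_one (by positivity),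
      ← Real.rpow_mul (abs_nonneg t), hq]
    congr 1
    push_cast
    ring
  rwa [e] at h2

end Weights

/-! ### Absorption and exponents -/

open scoped ENNReal in
/-- Absorption: a finite quantity bounded by a smaller power of itself. -/
theorem ENNReal.le_add_rpow_of_rpow_le {A C K η : ℝ≥0∞} {a b κ : ℝ} (hA : A ≠ ⊤) (hκ : 0 ≤ κ)
    (hb : 0 < b) (ha : a = κ + b) (h : A ^ a ≤ K * (C * (A + η)) ^ κ) :
    A ≤ η + (K * (2 * C) ^ κ) ^ (1 / b) := by
  rcases le_total A η with hη | hη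
  · exact hη.trans le_self_add
  by_cases hA0 : A = 0
  · simp [hA0]
  refine le_trans ?_ le_add_self
  -- In the remaining case `η ≤ A`, so `η` is replaced by `A`; the factor `A ^ κ` can be cancelled
  -- because `A` is neither zero nor infinite.
  have h1 : A ^ κ * A ^ b ≤ A ^ κ * (K * (2 * C) ^ κ) := by
    calc A ^ κ * A ^ b = A ^ a := by rw [ha, ENNReal.rpow_add_of_nonneg _ _ hκ hb.le]
      _ ≤ K * (C * (A + A)) ^ κ := h.trans (by gcongr)
      _ = K * (A * (2 * C)) ^ κ := by congr 2; ring
      _ = _ := by rw [ENNReal.mul_rpow_of_nonneg _ _ hκ]; ring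
  have h2 : A ^ b ≤ K * (2 * C) ^ κ :=
    (ENNReal.mul_le_mul_iff_right (by simp [hA0, hA]) (ENNReal.rpow_ne_top_of_nonneg hκ hA)).1 h1
  calc A = (A ^ b) ^ (1 / b) := by
        rw [← ENNReal.rpow_mul, mul_one_div_cancel hb.ne', ENNReal.rpow_one]
    _ ≤ _ := ENNReal.rpow_le_rpow h2 (by positivity)

section Exponents

variable {Q p m : ℝ}

theorem sobolevExponent_pos (hp : 0 < p) (hpQ : p < Q) : 0 < sobolevExponent Q p := by
  have : 0 < Q - p := by linarith
  have : 0 < Q := by linarith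
  rw [sobolevExponent]; positivity

theorem sobolevExponent_mono (hp : 0 < p) (hpm : p ≤ m) (hmQ : m < Q) :
    sobolevExponent Q p ≤ sobolevExponent Q m := by
  have : 0 < Q - m := by linarith
  have : 0 < m := by linarith
  have : 0 < Q := by linarith
  rw [sobolevExponent, sobolevExponent]
  gcongr

/-- Both sides equal `1 - p/Q`. The identity says that the Sobolev power `p/r` exceeds the Hölder
power `κ` by exactly `p/q`, the power that survives absorption. -/
theorem sobolevExponent_div_eq (hp : 1 < p) (hpQ : p < Q) (hm : p / (p - 1) ≤ m)
    (hmQ : m < Q / (p - 1)) : p / sobolevExponent Q p =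
      1 - p / (p - 1) / m + p / sobolevExponent Q (m * (p - 1)) := by
  have hp1 : 0 < p - 1 := by linarith
  have h1 : 0 < Q - p := by linarith
  have h2 : 0 < Q := by linarith
  have h3 : 0 < Q - m * (p - 1) := by rw [lt_div_iff₀ hp1] at hmQ; linarith
  have h4 : 0 < m := lt_of_lt_of_le (by positivity) hm
  rw [sobolevExponent, sobolevExponent]
  field_simp
  ring

end Exponents

/-! ### The limit `ε → 0` and the final estimate -/

section Final

open scoped ENNReal

/-- If the primitives of the truncated powers of `u` satisfy the energy estimate, then `u` satisfies
the `L^q` estimate. -/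
theorem lintegral_rpow_le_of_lintegral_primitive_le {α : Type*} [MeasurableSpace α] {μ : Measure α}
    [IsFiniteMeasure μ] {E : Type*} [NormedAddCommGroup E] {F : α → E} {u : α → ℝ}
    (hu : AEMeasurable u μ) (hF : AEMeasurable (fun x => ‖F x‖) μ) {p p' m r s q κ : ℝ} (hp : 0 < p)
    (hm : 0 < m) (hr : 0 < r) (hs : 0 ≤ s) (hq : q = r * (1 + 2 * s)) (hp' : 0 < p')
    (hκ : 0 ≤ κ) (hκm : p' / m + κ = 1) (hsκ : s * p = q / 2 * κ) (hpr : p / r = κ + p / q)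
    {K : ℝ≥0∞}
    (hmain : ∀ w : ℝ → ℝ, ContDiff ℝ ∞ w → (∀ t, 0 < w t) → (∃ B, ∀ t, w t ≤ B) →
      (∫⁻ x, ENNReal.ofReal (|∫ s in (0 : ℝ)..u x, w s| ^ r) ∂μ) ≠ ⊤ ∧
      (∫⁻ x, ENNReal.ofReal (|∫ s in (0 : ℝ)..u x, w s| ^ r) ∂μ) ^ (p / r) ≤
        K * ∫⁻ x, ENNReal.ofReal (‖F x‖ ^ p' * w (u x) ^ p) ∂μ) :
    ∫⁻ x, ENNReal.ofReal (|u x| ^ q) ∂μ ≤ ENNReal.ofReal ((2 * 4 ^ s) ^ r) *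
      (K * (∫⁻ x, ENNReal.ofReal (‖F x‖ ^ m) ∂μ) ^ (p' / m) *
        (2 * ENNReal.ofReal (2 ^ (r / 2) * (2 * 4 ^ s) ^ r + 2 ^ (q / 2))) ^ κ) ^ (q / p) := by
  have hq0 : 0 < q := by rw [hq]; positivity
  set C : ℝ := 2 ^ (r / 2) * (2 * 4 ^ s) ^ r + 2 ^ (q / 2) with hC
  have hC0 : 0 < C := by positivity
  set Ψ := ∫⁻ x, ENNReal.ofReal (‖F x‖ ^ m) ∂μ with hΨ
  set H : ℝ → ℝ → ℝ := fun ε t => |∫ τ in (0 : ℝ)..t, regSq ε τ ^ s| ^ r with hH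
  have hHm : ∀ ε > 0, AEMeasurable (fun x => H ε (u x)) μ := by
    intro ε hε
    have h1 : Continuous fun t => ∫ τ in (0 : ℝ)..t, regSq ε τ ^ s :=
      (contDiff_primitive (contDiff_regSq_rpow hε s)).1.continuous
    have h2 : Continuous (H ε) := h1.abs.rpow_const fun _ => Or.inr hr.le
    exact h2.measurable.comp_aemeasurable hu
  have hH0 : ∀ ε t, 0 ≤ H ε t := fun ε t => by positivity
  have hAbound : ∀ ε > 0, ∫⁻ x, ENNReal.ofReal (H ε (u x)) ∂μ ≤
      ENNReal.ofReal (ε ^ (q / 2)) * μ Set.univ +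
        (K * Ψ ^ (p' / m) * (2 * ENNReal.ofReal C) ^ κ) ^ (q / p) := by
    intro ε hε
    obtain ⟨hfin, hle⟩ := hmain _ (contDiff_regSq_rpow hε s)
      (fun t => Real.rpow_pos_of_pos (regSq_pos hε t) s) ⟨(ε⁻¹ + ε) ^ s, fun t =>
        Real.rpow_le_rpow (regSq_pos hε t).le (regSq_le_inv hε t) hs⟩
    have e : q / p = 1 / (p / q) := by field_simp
    rw [e]
    refine ENNReal.le_add_rpow_of_rpow_le hfin hκ (by positivity) hpr (hle.trans ?_)
    rw [mul_assoc]
    gcongr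
    have hV : ∫⁻ x, ENNReal.ofReal (C * (H ε (u x) + ε ^ (q / 2))) ∂μ =
        ENNReal.ofReal C * (∫⁻ x, ENNReal.ofReal (H ε (u x)) ∂μ +
          ENNReal.ofReal (ε ^ (q / 2)) * μ Set.univ) := by
      rw [← lintegral_const, ← lintegral_add_right _ measurable_const,
        ← lintegral_const_mul' _ _ ENNReal.ofReal_ne_top]
      refine lintegral_congr fun x => ?_
      rw [ENNReal.ofReal_mul hC0.le, ENNReal.ofReal_add (hH0 _ _) (by positivity)]
    rw [← hV]
    -- Hölder with weights `p'/m` and `κ`, the latter possibly zero. By `hsκ`, `w(u)^p` is the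
    -- `κ`-th power of `regSq ε u ^ (q/2)`.
    refine le_trans (lintegral_mono fun x => ?_) (ENNReal.lintegral_mul_norm_pow_le
      (hF.pow_const m).ennreal_ofReal (((hHm ε hε).add_const _).const_mul C).ennreal_ofReal
      (by positivity) hκ hκm)
    have hb := regSq_pos hε (u x)
    have hV0 : 0 ≤ C * (H ε (u x) + ε ^ (q / 2)) := by have := hH0 ε (u x); positivity
    dsimp only
    rw [ENNReal.ofReal_rpow_of_nonneg (by positivity) (by positivity),
      ENNReal.ofReal_rpow_of_nonneg hV0 hκ, ← ENNReal.ofReal_mul (by positivity),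
      ← Real.rpow_mul (norm_nonneg _), mul_div_cancel₀ _ hm.ne', ← Real.rpow_mul hb.le, hsκ,
      Real.rpow_mul hb.le]
    gcongr
    exact regSq_rpow_half_le hε hs hr hq (u x)
  set ε : ℕ → ℝ := fun n => 1 / ((n : ℝ) + 1) with hεdef
  have hε0 : ∀ n, 0 < ε n := fun n => Nat.one_div_pos_of_nat
  have hεlim : Tendsto ε atTop (𝓝 0) := tendsto_one_div_add_atTop_nhds_zero_nat
  -- The limit `|u|^q` is taken along `(|u| regSq^s)^r`, which the primitive dominates; Fatou's
  -- lemma then transfers the uniform bound.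
  have hpt : ∀ x, ENNReal.ofReal (|u x| ^ q) ≤
      liminf (fun n => ENNReal.ofReal ((2 * 4 ^ s) ^ r) * ENNReal.ofReal (H (ε n) (u x))) atTop := by
    intro x
    have h1 := ENNReal.tendsto_ofReal ((tendsto_abs_mul_regSq_rpow hs hr hq (u x)).comp hεlim)
    rw [← h1.liminf_eq]
    refine liminf_le_liminf (Eventually.of_forall fun n => ?_)
    rw [← ENNReal.ofReal_mul (by positivity), hH, ← Real.mul_rpow (by positivity) (abs_nonneg _)]
    have := regSq_pos (hε0 n) (u x)
    exact ENNReal.ofReal_le_ofReal (Real.rpow_le_rpow (by positivity)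
      (abs_mul_regSq_rpow_le (hε0 n) hs (u x)) hr.le)
  refine (lintegral_mono hpt).trans ((lintegral_liminf_le' fun n =>
    ((hHm _ (hε0 n)).ennreal_ofReal.const_mul _)).trans ?_)
  have hlim : Tendsto (fun n => ENNReal.ofReal ((2 * 4 ^ s) ^ r) *
      (ENNReal.ofReal (ε n ^ (q / 2)) * μ Set.univ +
        (K * Ψ ^ (p' / m) * (2 * ENNReal.ofReal C) ^ κ) ^ (q / p))) atTop
      (𝓝 (ENNReal.ofReal ((2 * 4 ^ s) ^ r) *
        (0 + (K * Ψ ^ (p' / m) * (2 * ENNReal.ofReal C) ^ κ) ^ (q / p)))) := by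
    refine ENNReal.Tendsto.const_mul (Tendsto.add_const _ ?_) (Or.inr ENNReal.ofReal_ne_top)
    have h1 : Tendsto (fun n => ENNReal.ofReal (ε n ^ (q / 2))) atTop (𝓝 0) := by
      have h2 := ENNReal.tendsto_ofReal (hεlim.rpow_const (p := q / 2) (Or.inr (by positivity)))
      rwa [Real.zero_rpow (by positivity), ENNReal.ofReal_zero] at h2
    simpa using ENNReal.Tendsto.mul_const h1 (Or.inr (measure_ne_top μ Set.univ))
  rw [zero_add] at hlim
  rw [← hlim.liminf_eq]
  refine liminf_le_liminf (Eventually.of_forall fun n => ?_)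
  rw [lintegral_const_mul' _ _ ENNReal.ofReal_ne_top]
  gcongr
  exact hAbound _ (hε0 n)

end Final

open scoped ENNReal in
theorem theorem4p4 {N d : ℕ} (hN : 2 ≤ N) (hd : 2 ≤ d)
    (X : Fin d → EuclideanSpace ℝ (Fin N) → EuclideanSpace ℝ (Fin N))
    (hX : ∀ j, LocallyLipschitz (X j))
    (hconn : IsXConnected X) (hequiv : CCDistEquivEuclidean X)
    (Q : ℝ) (hdoubling : IsCCDoubling X Q) (hpoincare : SupportsPoincare X)
    (Ω : Set (EuclideanSpace ℝ (Fin N))) (hΩ_open : IsOpen Ω) (hΩ_bdd : Bornology.IsBounded Ω)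
    (p : ℝ) (hp1 : 1 < p) (hpQ : p < Q)
    (m : ℝ) (hm : p / (p - 1) ≤ m) (hmQ : m < Q / (p - 1))
    (α : ℝ) (hα : 0 < α) :
    ∃ C : ℝ, 0 < C ∧
      ∀ (β : ℝ) (_ : 0 < β)
        (h : EuclideanSpace ℝ (Fin N) → ℝ)
        (_ : MemLp h (ENNReal.ofReal (p / (p - 1))) (volume.restrict Ω))
        (a : EuclideanSpace ℝ (Fin N) → ℝ → EuclideanSpace ℝ (Fin d) → EuclideanSpace ℝ (Fin d))
        (_ : IsLerayLions Ω p α β h a)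
        (F : EuclideanSpace ℝ (Fin N) → EuclideanSpace ℝ (Fin d))
        (_ : MemLp F (ENNReal.ofReal m) (volume.restrict Ω))
        (u : EuclideanSpace ℝ (Fin N) → ℝ) (_ : IsWeakSolution X Ω p a F u),
        MemLp u (ENNReal.ofReal (sobolevExponent Q (m * (p - 1)))) (volume.restrict Ω) ∧
          (eLpNorm u (ENNReal.ofReal (sobolevExponent Q (m * (p - 1))))
              (volume.restrict Ω)).toReal ≤
            C * (eLpNorm F (ENNReal.ofReal m) (volume.restrict Ω)).toReal ^ (1 / (p - 1)) := by
  have : NeZero N := ⟨by omega⟩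
  have hXc : ∀ j, Continuous (X j) := fun j => (hX j).continuous
  have hp0 : 0 < p := by linarith
  have hpm1 : 0 < p - 1 := by linarith
  have hp' : 0 < p / (p - 1) := by positivity
  have hm0 : 0 < m := hp'.trans_le hm
  have hpm : p ≤ m * (p - 1) := (div_le_iff₀ hpm1).1 hm
  have hmQ' : m * (p - 1) < Q := (lt_div_iff₀ hpm1).1 hmQ
  have hexp := sobolevExponent_div_eq hp1 hpQ hm hmQ
  have hr0 := sobolevExponent_pos hp0 hpQ
  have hrq := sobolevExponent_mono hp0 hpm hmQ'
  obtain ⟨S, hS, hS'⟩ := exists_sobolev_smooth hXc hconn hequiv hdoubling hpoincare hΩ_open hΩ_bdd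
    hp1 hpQ
  set q := sobolevExponent Q (m * (p - 1)) with hq
  set r := sobolevExponent Q p with hr
  have hq0 : 0 < q := hr0.trans_le hrq
  -- Chosen so that the `r`-th power of `|t|^{1+2s}` is `|t|^q`; `s ≥ 0` amounts to `p ≤ m(p-1)`,
  -- that is `p' ≤ m`.
  set s := (q / r - 1) / 2 with hs
  have hs0 : 0 ≤ s := by
    have : 1 ≤ q / r := (one_le_div hr0).2 hrq
    rw [hs]; linarith
  have hqs : q = r * (1 + 2 * s) := by rw [hs]; field_simp; ring
  set κ := 1 - p / (p - 1) / m with hκ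
  have hκ0 : 0 ≤ κ := by rw [hκ, sub_nonneg, div_le_one hm0]; exact hm
  have hsκ : s * p = q / 2 * κ := by
    have h1 : κ = p / r - p / q := by linarith
    rw [h1, hs]
    field_simp
  have : IsFiniteMeasure (volume.restrict Ω) := ⟨by simpa using hΩ_bdd.measure_lt_top⟩
  set K : ℝ≥0∞ := S ^ p * ENNReal.ofReal ((α ^ (-(1 / p))) ^ (p / (p - 1)) / α) with hK
  have hKtop : K ≠ ⊤ := ENNReal.mul_ne_top (ENNReal.rpow_ne_top_of_nonneg hp0.le hS)
    ENNReal.ofReal_ne_top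
  set C₁ : ℝ≥0∞ := 2 * ENNReal.ofReal (2 ^ (r / 2) * (2 * 4 ^ s) ^ r + 2 ^ (q / 2)) with hC₁
  set C₂ : ℝ≥0∞ := (ENNReal.ofReal ((2 * 4 ^ s) ^ r) * (K * C₁ ^ κ) ^ (q / p)) ^ (1 / q) with hC₂
  have hC₂top : C₂ ≠ ⊤ := by
    have h1 : C₁ ^ κ ≠ ⊤ := ENNReal.rpow_ne_top_of_nonneg hκ0
      (ENNReal.mul_ne_top ENNReal.ofNat_ne_top ENNReal.ofReal_ne_top)
    exact ENNReal.rpow_ne_top_of_nonneg (by positivity) (ENNReal.mul_ne_top ENNReal.ofReal_ne_top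
      (ENNReal.rpow_ne_top_of_nonneg (by positivity) (ENNReal.mul_ne_top hKtop h1)))
  -- Adding `1` only makes the constant strictly positive.
  refine ⟨C₂.toReal + 1, by positivity, fun β hβ h hh a ha F hF u ⟨Du, hu, heq⟩ => ?_⟩
  have hFp : MemLp F (ENNReal.ofReal (p / (p - 1))) (volume.restrict Ω) :=
    hF.mono_exponent (ENNReal.ofReal_le_ofReal hm)
  have key := lintegral_rpow_le_of_lintegral_primitive_le (F := F) hu.memLp.1.aemeasurable
    hF.1.norm.aemeasurable hp0 hm0 hr0 hs0 hqs hp' hκ0 (by rw [hκ]; ring) hsκ hexp (K := K)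
    fun w hw hw0 ⟨B, hB⟩ => by
      have := ha.lintegral_primitive_le hXc hp1 hα hβ.le hh hFp hu heq hr0 hS hS' hw hw0 hB
      rwa [← mul_assoc] at this
  have hnorm : eLpNorm u (ENNReal.ofReal q) (volume.restrict Ω) ≤
      C₂ * eLpNorm F (ENNReal.ofReal m) (volume.restrict Ω) ^ (1 / (p - 1)) := by
    rw [eLpNorm_ofReal_eq hq0, eLpNorm_ofReal_eq hm0]
    simp only [Real.norm_eq_abs]
    -- The integral of `‖F‖ ^ m` carries the power `(p'/m)(q/p)(1/q) = 1/(m(p-1))`.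
    refine (ENNReal.rpow_le_rpow key (by positivity)).trans_eq ?_
    rw [mul_right_comm, ENNReal.mul_rpow_of_nonneg (K * _) _ (by positivity), ← mul_assoc,
      ENNReal.mul_rpow_of_nonneg _ _ (by positivity), ← ENNReal.rpow_mul, ← ENNReal.rpow_mul,
      ← ENNReal.rpow_mul]
    congr 2
    field_simp
  have hFtop : eLpNorm F (ENNReal.ofReal m) (volume.restrict Ω) ^ (1 / (p - 1)) ≠ ⊤ :=
    ENNReal.rpow_ne_top_of_nonneg (by positivity) hF.2.ne
  refine ⟨⟨hu.memLp.1, lt_of_le_of_lt hnorm (ENNReal.mul_lt_top hC₂top.lt_top hFtop.lt_top)⟩, ?_⟩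
  refine (ENNReal.toReal_mono (ENNReal.mul_ne_top hC₂top hFtop) hnorm).trans ?_
  rw [ENNReal.toReal_mul, ENNReal.toReal_rpow]
  gcongr
  linarith
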